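/- **Theorem 4.7.** Let $M$ be a compact complex manifold with a Hermitian metric, let $\Delta\subset\mathbb C$ be the unit disc, and let $\phi:\Delta\to M$ be a holomorphic map with $$\int_\Delta (1-|x|)\,|\phi'(x)|^2\,d\lambda(x)=\infty,$$ where $\lambda$ is Lebesgue measure and $|\phi'(x)|$ is measured in the given metric. For $0<r<1$ put $$G_r(x)=\frac1{2\pi}\log^+\frac r{|x|},\qquad A(r)=\int_{\{|x|<r\}}(r-|x|)\,|\phi'(x)|^2\,d\lambda(x),$$ and let $T_r=\phi_*(G_r[\Delta])$, that is $\langle T_r,\eta\rangle=\int_\Delta G_r\,\phi^*\eta$ for every continuous $(1,1)$-form $\eta$ on $M$. Then each $T_r$ is a current of bidimension $(1,1)$ and order $0$ (a linear functional on the continuous $(1,1)$-forms, bounded for the sup norm). The family $T_r/A(r)$ has at least one weak cluster point as $r\to1^-$, and every weak cluster point $T$ is a current of bidimension $(1,1)$ and order $0$ such that 1. $T\neq0$, $T$ is positive, and $T$ is harmonic, i.e. $i\partial\bar\partial T=0$; 2. the support of $T$ is contained in $\overline{\phi(\Delta)}$; 3. if $\phi(\Delta)$ is contained in a leaf of a lamination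 by Riemann surfaces $(X,\mathcal L,E)$ in $M$, then $T$ is directed by $\mathcal L$. Here $X\subset M$ is compact, $E\subset X$ is closed (possibly empty), $\overline{X\setminus E}=X$, and $X\setminus E$ is covered by relatively open sets $U_i$ (flow boxes) with homeomorphisms $\Delta\times T_i\to U_i$, $T_i$ a topological space, that are holomorphic in the first variable $z$ and whose transition maps have the form $(z,t)\mapsto(h_{ij}(z,t),\lambda_{ij}(t))$ with $h_{ij}$ holomorphic in $z$. The images of the discs $\Delta\times\{t\}$ are the plaques; a leaf is a minimal nonempty connected subset of $X\setminus E$ that contains every plaque it meets. The current $T$ is directed by $\mathcal L$ if $\operatorname{supp}T\subset X$ and, with $k=\dim_{\mathbb C}M$, for every open $U\subset M\setminus E$ and all continuous nowhere vanishing $(1,0)$-forms $\gamma_1,\dots,\gamma_{k-1}$ along $X\cap U$ with $\gamma_j\wedge[P]=0$ on $U$ for every plaque $P$, one has $T\wedge\gamma_j=0$ on $U$ for all $j$. -/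

import Mathlib

open MeasureTheory Filter Metric
open scoped Manifold ContDiff Topology ComplexOrder

universe u u' v w

namespace HarmonicCurrents

noncomputable section

section Forms

variable {E : Type u} [NormedAddCommGroup E] [NormedSpace ℂ E]
variable {M : Type u'} [TopologicalSpace M] [ChartedSpace E M]

/-! The tangent space of the complex manifold `M` at `p` is the model space `E`, read through the
preferred chart `chartAt E p`; this is Mathlib's `TangentSpace 𝓘(ℂ, E) p`, with its complex
structure. A field of covectors or of bilinear forms on `M` is thus a map from `M` to a space of
linear or bilinear maps on `E`. Regularity is tested in charts: the components of the field in the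
chart centred at `x₀` are obtained with the derivative of the change of coordinates. -/

/-- The derivative at `p` of the change of coordinates from the chart at `x₀` to the chart at `p`:
it sends the components of a tangent vector at `p` in the chart at `x₀` to the vector itself. -/
def coordJac (x₀ p : M) : E →L[ℂ] E :=
  fderiv ℂ (chartAt E p ∘ (chartAt E x₀).symm) (chartAt E x₀ p)

/-- The components in the chart at `x₀` of a field of real bilinear forms on the tangent spaces. -/
def bilinInChart {F : Type*} [NormedAddCommGroup F] [NormedSpace ℝ F]
    (B : M → E →L[ℝ] E →L[ℝ] F) (x₀ p : M) : E →L[ℝ] E →L[ℝ] F :=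
  (B p).bilinearComp ((coordJac x₀ p : E →L[ℂ] E).restrictScalars ℝ)
    ((coordJac x₀ p : E →L[ℂ] E).restrictScalars ℝ)

variable (E M) in
/-- A smooth Hermitian metric on `M`, given by its real part: a smooth Riemannian metric invariant
under multiplication of tangent vectors by `i`. -/
structure HermitianMetric where
  inner : M → E →L[ℝ] E →L[ℝ] ℝ
  symm : ∀ p a b, inner p a b = inner p b a
  pos : ∀ p a, a ≠ 0 → 0 < inner p a a
  inner_I : ∀ p a b, inner p (Complex.I • a) (Complex.I • b) = inner p a b
  smooth : ∀ x₀ : M, ContMDiffOn 𝓘(ℝ, E) 𝓘(ℝ, E →L[ℝ] E →L[ℝ] ℝ) ∞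
    (bilinInChart inner x₀) (chartAt E x₀).source

/-- The length of the tangent vector `a` at `p`. -/
def HermitianMetric.length (g : HermitianMetric E M) (p : M) (a : E) : ℝ :=
  Real.sqrt (g.inner p a a)

variable (E M) in
/-- The complex vector space of continuous complex-valued differential forms of bidegree `(1,1)`
on `M`: alternating real bilinear forms on the tangent spaces, of type `(1,1)` (that is, invariant
under multiplication of both arguments by `i`), with continuous components in charts. -/
def ContForm11 : Submodule ℂ (M → E →L[ℝ] E →L[ℝ] ℂ) where
  carrier := {η | (∀ p a, η p a a = 0) ∧
    (∀ p a b, η p (Complex.I • a) (Complex.I • b) = η p a b) ∧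
    ∀ x₀ : M, ContinuousOn (bilinInChart η x₀) (chartAt E x₀).source}
  add_mem' := by
    rintro η θ ⟨h1, h2, h3⟩ ⟨k1, k2, k3⟩
    refine ⟨fun p a => by simp [h1, k1], fun p a b => by simp [h2, k2], fun x₀ => ?_⟩
    refine ((h3 x₀).add (k3 x₀)).congr fun p _ => ?_
    ext a b
    simp [bilinInChart]
  zero_mem' := by
    refine ⟨fun p a => by simp, fun p a b => by simp, fun x₀ => ?_⟩
    refine (continuousOn_const (c := (0 : E →L[ℝ] E →L[ℝ] ℂ))).congr fun p _ => ?_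
    ext a b
    simp [bilinInChart]
  smul_mem' := by
    rintro c η ⟨h1, h2, h3⟩
    refine ⟨fun p a => by simp [h1], fun p a b => by simp [h2], fun x₀ => ?_⟩
    refine ((h3 x₀).const_smul c).congr fun p _ => ?_
    ext a b
    simp [bilinInChart]

/-- Pointwise nonnegativity of a `(1,1)`-form: `η(a, i a) ≥ 0` for every tangent vector `a`;
for instance `(i/2) dz ∧ dz̄` on `ℂ`. -/
def IsNonneg (η : ContForm11 E M) : Prop :=
  ∀ p a, 0 ≤ (η : M → E →L[ℝ] E →L[ℝ] ℂ) p a (Complex.I • a)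

/-- The form `i∂∂̄F` at the point `y` of a complex vector space, `H` being the real Hessian of `F`:
`(i∂∂̄F)(a, b) = (H(i a, b) - H(a, i b)) / 2`. -/
def levi (F : E → ℂ) (y : E) : E →L[ℝ] E →L[ℝ] ℂ :=
  (1 / 2 : ℝ) • ((fderiv ℝ (fderiv ℝ F) y).bilinearComp
        ((Complex.I • ContinuousLinearMap.id ℂ E).restrictScalars ℝ) (ContinuousLinearMap.id ℝ E)
      - (fderiv ℝ (fderiv ℝ F) y).bilinearComp (ContinuousLinearMap.id ℝ E)
        ((Complex.I • ContinuousLinearMap.id ℂ E).restrictScalars ℝ))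

theorem levi_apply (F : E → ℂ) (y a b : E) :
    levi F y a b = (1 / 2 : ℝ) • (fderiv ℝ (fderiv ℝ F) y (Complex.I • a) b
      - fderiv ℝ (fderiv ℝ F) y a (Complex.I • b)) := by
  simp [levi]

/-- `i∂∂̄` commutes with holomorphic changes of variables. -/
theorem levi_comp {F : E → ℂ} {ψ : E → E} {y : E} (hF : ContDiffAt ℝ 2 F (ψ y))
    (hψ : ContDiffAt ℂ 2 ψ y) (a b : E) :
    levi (F ∘ ψ) y a b = levi F (ψ y) (fderiv ℂ ψ y a) (fderiv ℂ ψ y b) := by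
  have hψ1 : ∀ᶠ x in 𝓝 y, DifferentiableAt ℂ ψ x :=
    (hψ.eventually (by simp)).mono fun x hx => hx.differentiableAt (by norm_num)
  have hF1 : ∀ᶠ x in 𝓝 y, DifferentiableAt ℝ F (ψ x) :=
    (hψ.continuousAt.eventually (hF.eventually (by simp))).mono
      fun x hx => hx.differentiableAt (by norm_num)
  have e1 : fderiv ℝ (F ∘ ψ) =ᶠ[𝓝 y]
      fun x => (fderiv ℝ F (ψ x)).comp ((fderiv ℂ ψ x).restrictScalars ℝ) := by
    filter_upwards [hψ1, hF1] with x h1 h2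
    rw [fderiv_comp x h2 (h1.restrictScalars ℝ), h1.fderiv_restrictScalars ℝ]
  have d1 : DifferentiableAt ℂ (fderiv ℂ ψ) y :=
    (hψ.fderiv_right (m := 1) (by norm_num)).differentiableAt (by norm_num)
  have d2 : DifferentiableAt ℝ (fderiv ℝ F) (ψ y) :=
    (hF.fderiv_right (m := 1) (by norm_num)).differentiableAt (by norm_num)
  have d3 : HasFDerivAt (fun x => fderiv ℝ F (ψ x))
      ((fderiv ℝ (fderiv ℝ F) (ψ y)).comp ((fderiv ℂ ψ y).restrictScalars ℝ)) y :=
    d2.hasFDerivAt.comp y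
      ((hψ.differentiableAt (by norm_num)).hasFDerivAt.restrictScalars ℝ)
  have key : ∀ c d : E, fderiv ℝ (fderiv ℝ (F ∘ ψ)) y c d
      = fderiv ℝ (fderiv ℝ F) (ψ y) (fderiv ℂ ψ y c) (fderiv ℂ ψ y d)
        + fderiv ℝ F (ψ y) (fderiv ℂ (fderiv ℂ ψ) y c d) := by
    intro c d
    have f1 : HasFDerivAt (fun x => fderiv ℂ ψ x d)
        ((ContinuousLinearMap.apply ℂ E d).comp (fderiv ℂ (fderiv ℂ ψ) y)) y :=
      (ContinuousLinearMap.apply ℂ E d).hasFDerivAt.comp y d1.hasFDerivAt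
    have f2 := d3.clm_apply (f1.restrictScalars ℝ)
    have e2 : (fun x => fderiv ℝ (F ∘ ψ) x d) =ᶠ[𝓝 y]
        fun x => fderiv ℝ F (ψ x) (fderiv ℂ ψ x d) := by
      filter_upwards [e1] with x hx
      rw [hx]; rfl
    have dd : DifferentiableAt ℝ (fderiv ℝ (F ∘ ψ)) y :=
      ((hF.comp y (hψ.restrict_scalars ℝ)).fderiv_right (m := 1)
        (by norm_num)).differentiableAt (by norm_num)
    have f3 : HasFDerivAt (fun x => fderiv ℝ (F ∘ ψ) x d)
        ((ContinuousLinearMap.apply ℝ ℂ d).comp (fderiv ℝ (fderiv ℝ (F ∘ ψ)) y)) y :=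
      (ContinuousLinearMap.apply ℝ ℂ d).hasFDerivAt.comp y dd.hasFDerivAt
    have f4 := f3.unique (f2.congr_of_eventuallyEq e2)
    have f5 := congrArg (fun L : E →L[ℝ] ℂ => L c) f4
    simpa [add_comm] using f5
  rw [levi_apply, levi_apply, key, key]
  simp

/-- The pointwise form `i∂∂̄f` of a function `f` on `M`. -/
def ddbarAt (f : M → ℂ) (p : M) : E →L[ℝ] E →L[ℝ] ℂ :=
  levi (f ∘ (chartAt E p).symm) (chartAt E p p)

/-- Changes of charts are holomorphic. -/
theorem contDiffOn_coordChange [IsManifold 𝓘(ℂ, E) ω M] {e e' : OpenPartialHomeomorph M E}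
    (he : e ∈ atlas E M) (he' : e' ∈ atlas E M) :
    ContDiffOn ℂ ω (e' ∘ e.symm) (e.symm ≫ₕ e').source := by
  have h := (contDiffGroupoid ω 𝓘(ℂ, E)).compatible he he'
  rw [contDiffGroupoid, mem_groupoid_of_pregroupoid] at h
  simpa [contDiffPregroupoid] using h.1

variable (E M) in
/-- A complex manifold is a smooth real manifold. -/
theorem isManifold_real [IsManifold 𝓘(ℂ, E) ω M] : IsManifold 𝓘(ℝ, E) ∞ M := by
  refine isManifold_of_contDiffOn _ _ _ fun e e' he he' => ?_
  simpa using ((contDiffOn_coordChange he he').restrict_scalars ℝ).of_le le_top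

theorem continuousOn_levi {F : E → ℂ} {s : Set E}
    (h : ContinuousOn (fderiv ℝ (fderiv ℝ F)) s) : ContinuousOn (levi F) s := by
  have key : ∀ f k : E →L[ℝ] E,
      ContinuousOn (fun y => (fderiv ℝ (fderiv ℝ F) y).bilinearComp f k) s := fun f k => by
    have h1 := (ContinuousLinearMap.flipₗᵢ ℝ E E ℂ).continuous.comp_continuousOn
      (h.clm_comp (continuousOn_const (c := f)))
    exact (ContinuousLinearMap.flipₗᵢ ℝ E E ℂ).continuous.comp_continuousOn
      (h1.clm_comp (continuousOn_const (c := k)))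
  exact ((key _ _).sub (key _ _)).const_smul (1 / 2 : ℝ)

theorem contDiffOn_inChart [IsManifold 𝓘(ℂ, E) ω M] {f : M → ℂ}
    (hf : ContMDiff 𝓘(ℝ, E) 𝓘(ℝ, ℂ) ∞ f) (x₀ : M) :
    ContDiffOn ℝ ∞ (f ∘ (chartAt E x₀).symm) (chartAt E x₀).target := by
  have := isManifold_real E M
  rw [← contMDiffOn_iff_contDiffOn]
  exact hf.comp_contMDiffOn (contMDiffOn_chart_symm (I := 𝓘(ℝ, E)) (x := x₀))

theorem ddbarAt_mem [IsManifold 𝓘(ℂ, E) ω M] {f : M → ℂ}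
    (hf : ContMDiff 𝓘(ℝ, E) 𝓘(ℝ, ℂ) ∞ f) :
    (ddbarAt f : M → E →L[ℝ] E →L[ℝ] ℂ) ∈ ContForm11 E M := by
  have hsm : ∀ x₀ : M, ∀ y ∈ (chartAt E x₀).target,
      ContDiffAt ℝ ∞ (f ∘ (chartAt E x₀).symm) y := fun x₀ y hy =>
    (contDiffOn_inChart hf x₀).contDiffAt ((chartAt E x₀).open_target.mem_nhds hy)
  have hI : ∀ a : E, Complex.I • Complex.I • a = -a := fun a => by
    rw [smul_smul, Complex.I_mul_I, neg_one_smul]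
  refine ⟨fun p a => ?_, fun p a b => ?_, fun x₀ => ?_⟩
  · have hs : IsSymmSndFDerivAt ℝ (f ∘ (chartAt E p).symm) (chartAt E p p) :=
      (hsm p _ (mem_chart_target E p)).isSymmSndFDerivAt (by
        simp only [minSmoothness_of_isRCLikeNormedField]; exact WithTop.coe_le_coe.2 le_top)
    rw [ddbarAt, levi_apply, hs.eq (Complex.I • a) a, sub_self, smul_zero]
  · simp only [ddbarAt, levi_apply, hI, map_neg, _root_.neg_apply]
    congr 1
    ring
  · have hc : ContinuousOn (levi (f ∘ (chartAt E x₀).symm)) (chartAt E x₀).target := by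
      have h2 : ContinuousOn (fderiv ℝ (fderiv ℝ (f ∘ (chartAt E x₀).symm)))
          (chartAt E x₀).target := fun y hy =>
        ((((hsm x₀ y hy).fderiv_right (m := ∞) (by simp)).fderiv_right (m := ∞)
          (by simp)).continuousAt).continuousWithinAt
      exact continuousOn_levi h2
    refine (hc.comp (chartAt E x₀).continuousOn (chartAt E x₀).mapsTo).congr fun p hp => ?_
    have hy : (chartAt E x₀).symm (chartAt E x₀ p) = p := (chartAt E x₀).left_inv hp
    have hψ : ContDiffAt ℂ 2 (chartAt E p ∘ (chartAt E x₀).symm) (chartAt E x₀ p) := by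
      have h2 := contDiffOn_coordChange (chart_mem_atlas E x₀) (chart_mem_atlas E p)
      refine (h2.contDiffAt ?_).of_le le_top
      refine ((chartAt E x₀).symm.trans (chartAt E p)).open_source.mem_nhds ?_
      simp [hp]
    have hF : ContDiffAt ℝ 2 (f ∘ (chartAt E p).symm)
        ((chartAt E p ∘ (chartAt E x₀).symm) (chartAt E x₀ p)) := by
      refine (hsm p _ ?_).of_le (by exact WithTop.coe_le_coe.2 le_top)
      simp [hy]
    have hev : (f ∘ (chartAt E p).symm) ∘ (chartAt E p ∘ (chartAt E x₀).symm)
        =ᶠ[𝓝 (chartAt E x₀ p)] f ∘ (chartAt E x₀).symm := by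
      filter_upwards [((chartAt E x₀).symm.trans (chartAt E p)).open_source.mem_nhds
        (x := chartAt E x₀ p) (by simp [hp])] with y hy'
      simp only [OpenPartialHomeomorph.trans_source, Set.mem_inter_iff, Set.mem_preimage] at hy'
      simp [(chartAt E p).left_inv hy'.2]
    have hlev : levi ((f ∘ (chartAt E p).symm) ∘ (chartAt E p ∘ (chartAt E x₀).symm))
        (chartAt E x₀ p) = levi (f ∘ (chartAt E x₀).symm) (chartAt E x₀ p) := by
      unfold levi
      rw [hev.fderiv.fderiv_eq]
    ext a b
    have := levi_comp hF hψ a b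
    rw [hlev] at this
    simp only [Function.comp_apply, hy] at this
    simp only [Function.comp_apply, bilinInChart, ddbarAt, coordJac,
      ContinuousLinearMap.bilinearComp_apply, ContinuousLinearMap.coe_restrictScalars']
    exact this.symm

/-- The continuous `(1,1)`-form `i∂∂̄f` of a smooth function `f` on `M`. -/
def ddbar [IsManifold 𝓘(ℂ, E) ω M] (f : M → ℂ) (hf : ContMDiff 𝓘(ℝ, E) 𝓘(ℝ, ℂ) ∞ f) :
    ContForm11 E M :=
  ⟨ddbarAt f, ddbarAt_mem hf⟩

/-- A current of bidimension `(1,1)` and order `0` on the compact Hermitian manifold `(M, g)`: a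
linear functional on the continuous `(1,1)`-forms which is bounded for the comass norm, that is
`|T(η)| ≤ C sup |η|`. -/
structure Current (g : HermitianMetric E M) extends ContForm11 E M →ₗ[ℂ] ℂ where
  bounded : ∃ C : ℝ, ∀ (η : ContForm11 E M) (c : ℝ), 0 ≤ c →
    (∀ p a b, ‖(η : M → E →L[ℝ] E →L[ℝ] ℂ) p a b‖ ≤ c * g.length p a * g.length p b) →
    ‖toLinearMap η‖ ≤ C * c

instance (g : HermitianMetric E M) : CoeFun (Current g) fun _ => ContForm11 E M → ℂ :=
  ⟨fun T => T.toLinearMap⟩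

namespace Current

variable {g : HermitianMetric E M}

/-- `T` is positive. -/
def IsPositive (T : Current g) : Prop :=
  ∀ η : ContForm11 E M, IsNonneg η → 0 ≤ T η

/-- `T` is harmonic: `i∂∂̄T = 0`, that is `⟨T, i∂∂̄f⟩ = 0` for all smooth functions `f`. -/
def IsHarmonic [IsManifold 𝓘(ℂ, E) ω M] (T : Current g) : Prop :=
  ∀ (f : M → ℂ) (hf : ContMDiff 𝓘(ℝ, E) 𝓘(ℝ, ℂ) ∞ f), T (ddbar f hf) = 0

/-- The support of `T`: the complement of the largest open set on which `T` vanishes. -/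
def support (T : Current g) : Set M :=
  {p | ∀ U ∈ 𝓝 p, ∃ η : ContForm11 E M, tsupport (η : M → E →L[ℝ] E →L[ℝ] ℂ) ⊆ U ∧ T η ≠ 0}

end Current

/-- The derivative `φ'(x)`, a tangent vector at `φ(x)`, of a map `φ` defined on the unit disc. -/
def discDeriv (φ : ℂ → M) (x : ℂ) : E :=
  mfderiv 𝓘(ℂ, ℂ) 𝓘(ℂ, E) φ x (1 : ℂ)

/-- The weight `G_r(x) = (1/2π) log⁺(r/|x|)`. -/
def green (r : ℝ) (x : ℂ) : ℝ :=
  (2 * Real.pi)⁻¹ * Real.posLog (r / ‖x‖)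

/-- The density of `G_r φ^*η` with respect to Lebesgue measure on the disc, where
`φ^*η = η(φ'(x), i φ'(x)) dλ(x)`. -/
def greenPullback (φ : ℂ → M) (η : ContForm11 E M) (r : ℝ) (x : ℂ) : ℂ :=
  (green r x : ℂ) * (η : M → E →L[ℝ] E →L[ℝ] ℂ) (φ x) (discDeriv φ x)
    (Complex.I • discDeriv φ x)

/-- The pairing `⟨φ_*(G_r[Δ]), η⟩ = ∫_Δ G_r φ^*η`. -/
def pushGreen (φ : ℂ → M) (r : ℝ) (η : ContForm11 E M) : ℂ :=
  ∫ x in ball (0 : ℂ) 1, greenPullback φ η r x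

/-- The normalizing factor `A(r) = ∫_{|x| < r} (r - |x|) |φ'(x)|² dλ(x)`. -/
def massFactor (g : HermitianMetric E M) (φ : ℂ → M) (r : ℝ) : ℝ :=
  ∫ x in ball (0 : ℂ) r, (r - ‖x‖) * g.length (φ x) (discDeriv φ x) ^ 2

variable (E) in
/-- A flow box of a laminated set `Y`: a homeomorphism `(z, t) ↦ param z t` from the product of the
unit disc and a topological space onto a relatively open subset of `Y`, holomorphic in `z`. -/
structure FlowBox (Y : Set M) where
  T : Type v
  topT : TopologicalSpace T
  param : ℂ → T → M
  isEmbedding : Topology.IsEmbedding fun q : ball (0 : ℂ) 1 × T => param q.1 q.2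
  isOpen_box : ∃ V : Set M, IsOpen V ∧ {p | ∃ z ∈ ball (0 : ℂ) 1, ∃ t, param z t = p} = V ∩ Y
  holomorphic : ∀ t, MDifferentiableOn 𝓘(ℂ, ℂ) 𝓘(ℂ, E) (fun z => param z t) (ball 0 1)

namespace FlowBox

variable {Y : Set M}

/-- The plaque over `t`. -/
def plaque (B : FlowBox.{u, u', v} E Y) (t : B.T) : Set M :=
  (fun z => B.param z t) '' ball 0 1

/-- The subset of `Y` covered by the flow box. -/
def box (B : FlowBox.{u, u', v} E Y) : Set M := ⋃ t, B.plaque t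

/-- Compatibility: the change of flow boxes has the form `(z, t) ↦ (h(z, t), λ(t))` with `h`
holomorphic in `z`. -/
def Compatible (B B' : FlowBox.{u, u', v} E Y) : Prop :=
  ∀ t, (B.plaque t ∩ B'.box).Nonempty → ∃ (t' : B'.T) (h : ℂ → ℂ),
    DifferentiableOn ℂ h {z ∈ ball 0 1 | B.param z t ∈ B'.box} ∧
    ∀ z ∈ ball 0 1, B.param z t ∈ B'.box → h z ∈ ball 0 1 ∧ B'.param (h z) t' = B.param z t

end FlowBox

set_option linter.checkUnivs false in
variable (E M) in
/-- A compact set `X` laminated by Riemann surfaces outside a closed singular set `S` (which may be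
empty), with `X ∖ S` dense in `X`. -/
structure Lamination : Type (max u u' (v + 1) (w + 1)) where
  X : Set M
  S : Set M
  isCompact_X : IsCompact X
  isClosed_S : IsClosed S
  S_subset : S ⊆ X
  closure_diff : closure (X \ S) = X
  ι : Type w
  flowBox : ι → FlowBox.{u, u', v} E (X \ S)
  cover : ⋃ i, (flowBox i).box = X \ S
  compatible : ∀ i j, (flowBox i).Compatible (flowBox j)

namespace Lamination

/-- A leaf: a minimal nonempty connected subset of `X ∖ S` containing every plaque it meets. -/
def IsLeaf (Λ : Lamination.{u, u', v, w} E M) (L : Set M) : Prop :=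
  Minimal (fun A : Set M => A ⊆ Λ.X \ Λ.S ∧ IsConnected A ∧
    ∀ i t, ((Λ.flowBox i).plaque t ∩ A).Nonempty → (Λ.flowBox i).plaque t ⊆ A) L

/-- The `(1,0)`-forms `γ j` (complex linear forms on the tangent spaces) define the lamination on
the open set `U`: they are continuous and nowhere zero on `X ∩ U`, and `γ j ∧ [P] = 0` on `U` for
every plaque `P`, that is, `γ j` vanishes on the tangent vectors of the plaques. -/
def DefinedBy (Λ : Lamination.{u, u', v, w} E M) (U : Set M) {J : Type*}
    (γ : J → M → E →L[ℂ] ℂ) : Prop :=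
  ∀ j,
    (∀ x₀ : M, ContinuousOn (fun p => (γ j p).comp (coordJac x₀ p))
      (Λ.X ∩ U ∩ (chartAt E x₀).source)) ∧
    (∀ p ∈ Λ.X ∩ U, γ j p ≠ 0) ∧
    ∀ i t, ∀ z ∈ ball (0 : ℂ) 1, (Λ.flowBox i).param z t ∈ U →
      γ j ((Λ.flowBox i).param z t) (discDeriv (fun ζ => (Λ.flowBox i).param ζ t) z) = 0

/-- `T ∧ γ = 0` on the open set `U`, where `T` is supported on `X` and the `(1,0)`-form `γ` is
given on `X ∩ U`: for every continuous `(0,1)`-form `β` (conjugate-linear forms on the tangent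
spaces) with compact support in `U`, `T` annihilates `γ ∧ β`. As `γ` is only given along `X`, the
test form `η` is any continuous form supported in `U` that equals `γ ∧ β` on `X ∩ U`. -/
def WedgeEqZero (Λ : Lamination.{u, u', v, w} E M) {g : HermitianMetric E M} (T : Current g)
    (U : Set M) (γ : M → E →L[ℂ] ℂ) : Prop :=
  ∀ β : M → E →L⋆[ℂ] ℂ,
    (∀ x₀ : M, ContinuousOn (fun p => (β p).comp (coordJac x₀ p)) (chartAt E x₀).source) →
    tsupport β ⊆ U →
    ∀ η : ContForm11 E M, tsupport (η : M → E →L[ℝ] E →L[ℝ] ℂ) ⊆ U →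
      (∀ p ∈ Λ.X ∩ U, ∀ a b, (η : M → E →L[ℝ] E →L[ℝ] ℂ) p a b
        = γ p a * β p b - γ p b * β p a) →
      T η = 0

/-- The current `T` is directed by the lamination: it is supported on `X`, and `T ∧ γ_j = 0` on
every open set `U` on which the lamination is defined by continuous nonvanishing `(1,0)`-forms
`γ_1, …, γ_{k-1}`, where `k = dim M`. -/
def Directs (Λ : Lamination.{u, u', v, w} E M) {g : HermitianMetric E M} (T : Current g) : Prop :=
  T.support ⊆ Λ.X ∧
  ∀ U : Set M, IsOpen U → Disjoint U Λ.S →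
    ∀ γ : Fin (Module.finrank ℂ E - 1) → M → E →L[ℂ] ℂ, Λ.DefinedBy U γ →
      ∀ j, Λ.WedgeEqZero T U (γ j)

end Lamination

end Forms

end

end HarmonicCurrents

namespace HarmonicCurrents

noncomputable section

/-! ### Charts, comass, and the pull-back of `i∂∂̄f` to the disc -/

section Charts

variable {E : Type u} [NormedAddCommGroup E] [NormedSpace ℂ E]
variable {M : Type u'} [TopologicalSpace M] [ChartedSpace E M]

/-! The weight `G_r` is the Green function of the disc of radius `r` with pole at the centre, and
holomorphy of `φ` gives `φ^*(i∂∂̄f) = ½ Δ(f ∘ φ) dλ` (`contDiffAt_comp_disc`). A Jensen formula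
therefore turns `⟨T_r, i∂∂̄f⟩` into circle means of `f ∘ φ`, which are bounded because `f` is
bounded on the compact manifold, plus terms near the pole that stay bounded as `r` varies
(`pushGreen_ddbar_bounded`). So `⟨T_r, i∂∂̄f⟩` is bounded as `r → 1`.

The mass of `T_r`, obtained by testing on the fundamental form, is `∫ G_r |φ'|²`. Elementary
inequalities for the logarithm compare `G_r` with `r - |x|`, so this mass is at least `A(r) / 2π`
and, for `r` near `1`, at most a constant times `A(r)`. Moreover `A(r) → ∞` by monotone convergence.
The upper bound gives cluster points by Tychonoff's theorem and makes them of order `0`; the lower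
bound makes them nonzero; dividing the bounded pairing with `i∂∂̄f` by `A(r)` makes them harmonic.
Linearity, positivity and vanishing on a given form are closed conditions for pointwise convergence
on forms, hence pass to every cluster point.

For directedness, minimality of a leaf shows that it meets only countably many plaques of a flow box
(`IsLeaf.countable_plaques`). A disc inside the leaf has locally a connected, countable set of
transversal positions, that is, a single one (`IsLeaf.exists_plaque`). Hence `φ'` is tangent to the
plaques, the forms `γ_j` kill it, and `γ_j ∧ β` pulls back to zero on the disc. -/

theorem differentiableAt_chart_comp [IsManifold 𝓘(ℂ, E) ω M] {f : ℂ → M} {x : ℂ}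
    (hf : MDifferentiableAt 𝓘(ℂ, ℂ) 𝓘(ℂ, E) f x) {x₀ : M} (hx : f x ∈ (chartAt E x₀).source) :
    DifferentiableAt ℂ (chartAt E x₀ ∘ f) x := by
  rw [← mdifferentiableAt_iff_differentiableAt]
  refine MDifferentiableAt.comp x (I' := 𝓘(ℂ, E)) ?_ hf
  have := mdifferentiableAt_atlas (I := 𝓘(ℂ, E)) (chart_mem_atlas E x₀) hx
  exact this

theorem contDiffAt_coordChange [IsManifold 𝓘(ℂ, E) ω M] {x₀ x₁ p : M}
    (h₀ : p ∈ (chartAt E x₀).source) (h₁ : p ∈ (chartAt E x₁).source) :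
    ContDiffAt ℂ ω (chartAt E x₁ ∘ (chartAt E x₀).symm) (chartAt E x₀ p) := by
  have h2 := contDiffOn_coordChange (chart_mem_atlas E x₀) (chart_mem_atlas E x₁)
  refine h2.contDiffAt (((chartAt E x₀).symm.trans (chartAt E x₁)).open_source.mem_nhds ?_)
  simp [h₀, h₁]

theorem discDeriv_eq_deriv (f : ℂ → M) {x : ℂ} (hf : MDifferentiableAt 𝓘(ℂ, ℂ) 𝓘(ℂ, E) f x) :
    discDeriv (E := E) f x = deriv (chartAt E (f x) ∘ f) x := by
  have h : discDeriv (E := E) f x = fderivWithin ℂ (writtenInExtChartAt 𝓘(ℂ, ℂ) 𝓘(ℂ, E) x f)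
      (Set.range 𝓘(ℂ, ℂ)) (extChartAt 𝓘(ℂ, ℂ) x x) (1 : ℂ) :=
    congrArg (fun L : ℂ →L[ℂ] E => L 1) hf.mfderiv
  rw [h]
  simp [writtenInExtChartAt, Function.comp_def, chartAt_self_eq]

/-- The derivative of a holomorphic disc, through its components in the chart at `x₀`. -/
theorem discDeriv_eq_coordJac [IsManifold 𝓘(ℂ, E) ω M] {f : ℂ → M} {x : ℂ}
    (hf : MDifferentiableAt 𝓘(ℂ, ℂ) 𝓘(ℂ, E) f x) {x₀ : M} (hx : f x ∈ (chartAt E x₀).source) :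
    discDeriv (E := E) f x = coordJac x₀ (f x) (deriv (chartAt E x₀ ∘ f) x) := by
  rw [discDeriv_eq_deriv f hf]
  have h1 := (differentiableAt_chart_comp hf hx).hasDerivAt
  have h2 := ((contDiffAt_coordChange hx (mem_chart_source E (f x))).differentiableAt
    (by simp)).hasFDerivAt
  have h3 := h2.comp_hasDerivAt x (f := chartAt E x₀ ∘ f) h1
  refine (h3.congr_of_eventuallyEq ?_).deriv
  filter_upwards [hf.continuousAt.eventually ((chartAt E x₀).open_source.mem_nhds hx)] with y hy
  simp [(chartAt E x₀).left_inv hy]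

/-- The derivative of the inverse change of coordinates is a right inverse, by the chain rule. This
lets an estimate on chart components be read as an estimate on all tangent vectors at `p`. -/
theorem coordJac_surjective [IsManifold 𝓘(ℂ, E) ω M] {x₀ p : M}
    (hp : p ∈ (chartAt E x₀).source) : Function.Surjective (coordJac (E := E) x₀ p) := by
  intro a
  have h1 := ((contDiffAt_coordChange (mem_chart_source E p) hp).differentiableAt
    (by simp)).hasFDerivAt
  have h2 := ((contDiffAt_coordChange hp (mem_chart_source E p)).differentiableAt
    (by simp)).hasFDerivAt
  have h0 : (chartAt E x₀ ∘ (chartAt E p).symm) (chartAt E p p) = chartAt E x₀ p := by simp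
  rw [← h0] at h2
  have h3 := h2.comp _ h1
  have h4 : HasFDerivAt ((chartAt E p ∘ (chartAt E x₀).symm) ∘ (chartAt E x₀ ∘ (chartAt E p).symm))
      (ContinuousLinearMap.id ℂ E) (chartAt E p p) := by
    refine (hasFDerivAt_id _).congr_of_eventuallyEq ?_
    filter_upwards [((chartAt E p).symm.trans (chartAt E x₀)).open_source.mem_nhds
        (x := chartAt E p p) (by simp [hp])] with y hy
    simp only [OpenPartialHomeomorph.trans_source, Set.mem_inter_iff, Set.mem_preimage] at hy
    simp [(chartAt E x₀).left_inv hy.2, (chartAt E p).right_inv hy.1]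
  have h5 := h3.unique h4
  rw [h0] at h5
  exact ⟨_, congrArg (fun L : E →L[ℂ] E => L a) h5⟩

/-- Fields of bilinear forms with continuous components, evaluated on the velocity of a holomorphic
disc, give continuous functions. -/
theorem continuousOn_bilin_discDeriv [CompleteSpace E] [IsManifold 𝓘(ℂ, E) ω M] {F : Type*}
    [NormedAddCommGroup F]
    [NormedSpace ℝ F] {B : M → E →L[ℝ] E →L[ℝ] F}
    (hB : ∀ x₀ : M, ContinuousOn (bilinInChart B x₀) (chartAt E x₀).source)
    {φ : ℂ → M} {s : Set ℂ} (hs : IsOpen s) (hφ : MDifferentiableOn 𝓘(ℂ, ℂ) 𝓘(ℂ, E) φ s) (c : ℂ) :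
    ContinuousOn (fun x => B (φ x) (discDeriv φ x) (c • discDeriv φ x)) s := by
  have hd : ∀ x ∈ s, MDifferentiableAt 𝓘(ℂ, ℂ) 𝓘(ℂ, E) φ x := fun x hx =>
    hφ.mdifferentiableAt (hs.mem_nhds hx)
  intro x hx
  refine ContinuousAt.continuousWithinAt ?_
  have hsrc : ∀ᶠ y in 𝓝 x, φ y ∈ (chartAt E (φ x)).source :=
    (hd x hx).continuousAt.eventually
      ((chartAt E (φ x)).open_source.mem_nhds (mem_chart_source E (φ x)))
  have hdiff : ∀ᶠ y in 𝓝 x, DifferentiableAt ℂ (chartAt E (φ x) ∘ φ) y := by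
    filter_upwards [hsrc, hs.mem_nhds hx] with y hy hys
    exact differentiableAt_chart_comp (hd y hys) hy
  -- Complex differentiability near `x` upgrades to analyticity, which is what makes the velocity
  -- continuous.
  have han : AnalyticAt ℂ (chartAt E (φ x) ∘ φ) x :=
    Complex.analyticAt_iff_eventually_differentiableAt.2 hdiff
  have h1 : ContinuousAt (deriv (chartAt E (φ x) ∘ φ)) x := han.deriv.continuousAt
  have h2 : ContinuousAt (fun y => bilinInChart B (φ x) (φ y)) x :=
    ContinuousAt.comp (f := φ) (x := x) ((hB (φ x)).continuousAt
      ((chartAt E (φ x)).open_source.mem_nhds (mem_chart_source E (φ x)))) (hd x hx).continuousAt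
  refine ((h2.clm_apply h1).clm_apply (h1.const_smul c)).congr ?_
  filter_upwards [hsrc, hs.mem_nhds hx] with y hy hys
  rw [discDeriv_eq_coordJac (hd y hys) hy]
  simp [bilinInChart]

theorem HermitianMetric.continuousOn_bilinInChart (g : HermitianMetric E M) (x₀ : M) :
    ContinuousOn (bilinInChart g.inner x₀) (chartAt E x₀).source :=
  (g.smooth x₀).continuousOn

theorem HermitianMetric.inner_self_nonneg (g : HermitianMetric E M) (p : M) (a : E) :
    0 ≤ g.inner p a a := by
  by_cases h : a = 0
  · simp [h]
  · exact (g.pos p a h).le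

theorem HermitianMetric.length_sq (g : HermitianMetric E M) (p : M) (a : E) :
    g.length p a ^ 2 = g.inner p a a :=
  Real.sq_sqrt (g.inner_self_nonneg p a)

theorem HermitianMetric.length_nonneg (g : HermitianMetric E M) (p : M) (a : E) :
    0 ≤ g.length p a :=
  Real.sqrt_nonneg _

theorem HermitianMetric.length_I_smul (g : HermitianMetric E M) (p : M) (a : E) :
    g.length p (Complex.I • a) = g.length p a := by
  simp [HermitianMetric.length, g.inner_I]

theorem coordJac_self (p : M) : coordJac (E := E) p p = ContinuousLinearMap.id ℂ E := by
  rw [coordJac, Filter.EventuallyEq.fderiv_eq (f₁ := _) (f := id), fderiv_id]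
  filter_upwards [(chartAt E p).open_target.mem_nhds (mem_chart_target E p)] with y hy
  simp [(chartAt E p).right_inv hy]

/-- On a compact set of tangent vectors the Hermitian metric is bounded below. -/
theorem HermitianMetric.exists_pos_le_inner [FiniteDimensional ℂ E] (g : HermitianMetric E M)
    (p : M) : ∃ δ > 0, ∀ a, δ * ‖a‖ ^ 2 ≤ g.inner p a a := by
  have : FiniteDimensional ℝ E := FiniteDimensional.complexToReal E
  have : ProperSpace E := FiniteDimensional.proper ℝ E
  have hc : Continuous fun a => g.inner p a a :=
    (g.inner p).continuous.clm_apply continuous_id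
  rcases subsingleton_or_nontrivial E with hE | hE
  · exact ⟨1, one_pos, fun a => by simp [Subsingleton.elim a 0]⟩
  obtain ⟨b, hb, hmin⟩ := (isCompact_sphere (0 : E) 1).exists_isMinOn
    (NormedSpace.sphere_nonempty.2 zero_le_one) hc.continuousOn
  have hb0 : b ≠ 0 := by
    rintro rfl
    simp at hb
  refine ⟨g.inner p b b, g.pos p b hb0, fun a => ?_⟩
  by_cases ha : a = 0
  · simp [ha]
  have hna : ‖a‖ ≠ 0 := norm_ne_zero_iff.2 ha
  have h := hmin (a := ‖a‖⁻¹ • a) (by simp [norm_smul, hna])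
  simp only [Set.mem_ofPred_eq, map_smul, _root_.smul_apply, smul_eq_mul] at h
  calc g.inner p b b * ‖a‖ ^ 2 ≤ (‖a‖⁻¹ * (‖a‖⁻¹ * g.inner p a a)) * ‖a‖ ^ 2 := by gcongr
    _ = g.inner p a a := by field_simp

/-- A perturbation of size `δ / 2` costs at most half of the lower bound `δ ‖a‖²`, so `√(δ / 2) ‖a‖
≤ √(G a a)`. Using this once for `a` and once for `b` produces the factor `2 / δ`. -/
theorem norm_bilin_le_of_near {F : Type*} [NormedAddCommGroup F] [NormedSpace ℝ F]
    {B : E →L[ℝ] E →L[ℝ] F} {G G₀ : E →L[ℝ] E →L[ℝ] ℝ} {δ K : ℝ} (hδ : 0 < δ)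
    (h₀ : ∀ a, δ * ‖a‖ ^ 2 ≤ G₀ a a) (hG : ‖G - G₀‖ ≤ δ / 2) (hB : ‖B‖ ≤ K) (a b : E) :
    ‖B a b‖ ≤ 2 * K / δ * √(G a a) * √(G b b) := by
  have hK : 0 ≤ K := (norm_nonneg B).trans hB
  have key : ∀ a, √(δ / 2) * ‖a‖ ≤ √(G a a) := fun a => by
    have h1 : ‖(G - G₀) a a‖ ≤ δ / 2 * ‖a‖ * ‖a‖ :=
      ((G - G₀).le_opNorm₂ a a).trans (by gcongr)
    have h2 : -((G - G₀) a a) ≤ δ / 2 * ‖a‖ * ‖a‖ := (neg_le_abs _).trans h1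
    have h3 : δ / 2 * ‖a‖ ^ 2 ≤ G a a := by
      have := h₀ a
      simp only [_root_.sub_apply] at h2
      nlinarith
    calc √(δ / 2) * ‖a‖ = √(δ / 2 * ‖a‖ ^ 2) := by
          rw [Real.sqrt_mul (by positivity), Real.sqrt_sq (norm_nonneg a)]
      _ ≤ √(G a a) := Real.sqrt_le_sqrt h3
  have hs : √(δ / 2) * √(δ / 2) = δ / 2 := Real.mul_self_sqrt (by positivity)
  calc ‖B a b‖ ≤ K * ‖a‖ * ‖b‖ := (B.le_opNorm₂ a b).trans (by gcongr)
    _ = 2 * K / δ * (√(δ / 2) * ‖a‖) * (√(δ / 2) * ‖b‖) := by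
        have : 2 * K / δ * (√(δ / 2) * ‖a‖) * (√(δ / 2) * ‖b‖)
          = 2 * K / δ * (√(δ / 2) * √(δ / 2)) * ‖a‖ * ‖b‖ := by ring
        rw [this, hs]
        field_simp
    _ ≤ _ := by gcongr <;> exact key _

/-- A field of bilinear forms with continuous components on a compact Hermitian manifold has finite
comass. -/
theorem exists_comass_bound [FiniteDimensional ℂ E] [IsManifold 𝓘(ℂ, E) ω M] [CompactSpace M]
    (g : HermitianMetric E M) {F : Type*} [NormedAddCommGroup F] [NormedSpace ℝ F]
    {B : M → E →L[ℝ] E →L[ℝ] F}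
    (hB : ∀ x₀ : M, ContinuousOn (bilinInChart B x₀) (chartAt E x₀).source) :
    ∃ c : ℝ, 0 ≤ c ∧ ∀ p a b, ‖B p a b‖ ≤ c * g.length p a * g.length p b := by
  have hloc : ∀ x₀ : M, ∃ c : ℝ, ∀ᶠ p in 𝓝 x₀, ∀ a b,
      ‖B p a b‖ ≤ c * g.length p a * g.length p b := by
    intro x₀
    have hx : (chartAt E x₀).source ∈ 𝓝 x₀ :=
      (chartAt E x₀).open_source.mem_nhds (mem_chart_source E x₀)
    obtain ⟨δ, hδ, hmin⟩ := g.exists_pos_le_inner x₀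
    have c1 : ContinuousAt (bilinInChart g.inner x₀) x₀ :=
      (g.continuousOn_bilinInChart x₀).continuousAt hx
    have c2 : ContinuousAt (bilinInChart B x₀) x₀ := (hB x₀).continuousAt hx
    have e1 : ∀ᶠ p in 𝓝 x₀, ‖bilinInChart g.inner x₀ p - bilinInChart g.inner x₀ x₀‖ ≤ δ / 2 := by
      have hb : closedBall (bilinInChart g.inner x₀ x₀) (δ / 2) ∈ 𝓝 (bilinInChart g.inner x₀ x₀) :=
        closedBall_mem_nhds (α := E →L[ℝ] E →L[ℝ] ℝ) _ (half_pos hδ)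
      filter_upwards [c1.preimage_mem_nhds hb] with p hp
      exact (dist_eq_norm (bilinInChart g.inner x₀ p) (bilinInChart g.inner x₀ x₀)).symm.le.trans hp
    have e2 : ∀ᶠ p in 𝓝 x₀, ‖bilinInChart B x₀ p‖ ≤ ‖bilinInChart B x₀ x₀‖ + 1 := by
      have hb : {L : E →L[ℝ] E →L[ℝ] F | ‖L‖ < ‖bilinInChart B x₀ x₀‖ + 1}
          ∈ 𝓝 (bilinInChart B x₀ x₀) :=
        (isOpen_lt (continuous_norm (E := E →L[ℝ] E →L[ℝ] F)) continuous_const).mem_nhds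
          (lt_add_one ‖bilinInChart B x₀ x₀‖)
      filter_upwards [c2.preimage_mem_nhds hb] with p hp
      exact le_of_lt hp
    refine ⟨2 * (‖bilinInChart B x₀ x₀‖ + 1) / δ, ?_⟩
    filter_upwards [hx, e1, e2] with p hp h1 h2 a b
    obtain ⟨a, rfl⟩ := coordJac_surjective hp a
    obtain ⟨b, rfl⟩ := coordJac_surjective hp b
    exact norm_bilin_le_of_near hδ (G₀ := bilinInChart g.inner x₀ x₀)
      (fun a => by simpa [bilinInChart, coordJac_self] using hmin a) h1 h2 a b
  choose c hc using hloc
  obtain ⟨t, -, ht⟩ := isCompact_univ.elim_nhds_subcover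
    (fun x₀ => {p | ∀ a b, ‖B p a b‖ ≤ c x₀ * g.length p a * g.length p b}) fun x₀ _ => hc x₀
  -- The sum over the finite subcover dominates each local constant and is nonnegative even if some
  -- of these are not.
  refine ⟨∑ x ∈ t, |c x|, by positivity, fun p a b => ?_⟩
  obtain ⟨x, hxt, hx⟩ := Set.mem_iUnion₂.1 (ht (Set.mem_univ p))
  refine (hx a b).trans ?_
  have hle : c x ≤ ∑ x ∈ t, |c x| :=
    (le_abs_self _).trans (Finset.single_le_sum (f := fun x => |c x|)
      (fun _ _ => abs_nonneg _) hxt)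
  have := g.length_nonneg p a
  have := g.length_nonneg p b
  gcongr

/-- The Laplacian of a function on the complex plane. -/
def lap (U : ℂ → ℂ) (x : ℂ) : ℂ :=
  fderiv ℝ (fderiv ℝ U) x 1 1 + fderiv ℝ (fderiv ℝ U) x Complex.I Complex.I

/-- The second derivative of the composite of a function with a holomorphic curve. -/
theorem fderiv_fderiv_comp {F : E → ℂ} {ψ : ℂ → E} {y : ℂ} (hF : ContDiffAt ℝ 2 F (ψ y))
    (hψ : ContDiffAt ℂ 2 ψ y) (c d : ℂ) :
    fderiv ℝ (fderiv ℝ (F ∘ ψ)) y c d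
      = fderiv ℝ (fderiv ℝ F) (ψ y) (fderiv ℂ ψ y c) (fderiv ℂ ψ y d)
        + fderiv ℝ F (ψ y) (fderiv ℂ (fderiv ℂ ψ) y c d) := by
  have hψ1 : ∀ᶠ x in 𝓝 y, DifferentiableAt ℂ ψ x :=
    (hψ.eventually (by simp)).mono fun x hx => hx.differentiableAt (by norm_num)
  have hF1 : ∀ᶠ x in 𝓝 y, DifferentiableAt ℝ F (ψ x) :=
    (hψ.continuousAt.eventually (hF.eventually (by simp))).mono
      fun x hx => hx.differentiableAt (by norm_num)
  have e1 : fderiv ℝ (F ∘ ψ) =ᶠ[𝓝 y]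
      fun x => (fderiv ℝ F (ψ x)).comp ((fderiv ℂ ψ x).restrictScalars ℝ) := by
    filter_upwards [hψ1, hF1] with x h1 h2
    rw [fderiv_comp x h2 (h1.restrictScalars ℝ), h1.fderiv_restrictScalars ℝ]
  have d1 : DifferentiableAt ℂ (fderiv ℂ ψ) y :=
    (hψ.fderiv_right (m := 1) (by norm_num)).differentiableAt (by norm_num)
  have d2 : DifferentiableAt ℝ (fderiv ℝ F) (ψ y) :=
    (hF.fderiv_right (m := 1) (by norm_num)).differentiableAt (by norm_num)
  have d3 : HasFDerivAt (fun x => fderiv ℝ F (ψ x))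
      ((fderiv ℝ (fderiv ℝ F) (ψ y)).comp ((fderiv ℂ ψ y).restrictScalars ℝ)) y :=
    d2.hasFDerivAt.comp y
      ((hψ.differentiableAt (by norm_num)).hasFDerivAt.restrictScalars ℝ)
  have f1 : HasFDerivAt (fun x => fderiv ℂ ψ x d)
      ((ContinuousLinearMap.apply ℂ E d).comp (fderiv ℂ (fderiv ℂ ψ) y)) y :=
    (ContinuousLinearMap.apply ℂ E d).hasFDerivAt.comp y d1.hasFDerivAt
  have f2 := d3.clm_apply (f1.restrictScalars ℝ)
  have e2 : (fun x => fderiv ℝ (F ∘ ψ) x d) =ᶠ[𝓝 y]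
      fun x => fderiv ℝ F (ψ x) (fderiv ℂ ψ x d) := by
    filter_upwards [e1] with x hx
    rw [hx]; rfl
  have dd : DifferentiableAt ℝ (fderiv ℝ (F ∘ ψ)) y :=
    ((hF.comp y (hψ.restrict_scalars ℝ)).fderiv_right (m := 1)
      (by norm_num)).differentiableAt (by norm_num)
  have f3 : HasFDerivAt (fun x => fderiv ℝ (F ∘ ψ) x d)
      ((ContinuousLinearMap.apply ℝ ℂ d).comp (fderiv ℝ (fderiv ℝ (F ∘ ψ)) y)) y :=
    (ContinuousLinearMap.apply ℝ ℂ d).hasFDerivAt.comp y dd.hasFDerivAt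
  have f4 := f3.unique (f2.congr_of_eventuallyEq e2)
  have f5 := congrArg (fun L : ℂ →L[ℝ] ℂ => L c) f4
  simpa [add_comm] using f5

/-- The terms of the chain rule containing `ψ''` cancel: `ψ''` is complex bilinear, so `ψ''(i, i) =
-ψ''(1, 1)`. What remains is the Hessian of `F` on `(ψ', ψ')` and on `(iψ', iψ')`, whose sum is
twice the Levi form on `(ψ', iψ')`. -/
theorem lap_comp {F : E → ℂ} {ψ : ℂ → E} {y : ℂ} (hF : ContDiffAt ℝ 2 F (ψ y))
    (hψ : ContDiffAt ℂ 2 ψ y) :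
    levi F (ψ y) (deriv ψ y) (Complex.I • deriv ψ y) = (1 / 2 : ℝ) • lap (F ∘ ψ) y := by
  have h1 : ∀ c : ℂ, fderiv ℂ ψ y c = c • deriv ψ y := fun c => by
    rw [← fderiv_apply_one_eq_deriv, ← map_smul, smul_eq_mul, mul_one]
  have h2 : fderiv ℂ (fderiv ℂ ψ) y Complex.I Complex.I = -fderiv ℂ (fderiv ℂ ψ) y 1 1 := by
    have h : (Complex.I : ℂ) = Complex.I • (1 : ℂ) := by simp
    have h3 := congrArg (fun L : ℂ →L[ℂ] E => L Complex.I)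
      ((fderiv ℂ (fderiv ℂ ψ) y).map_smul Complex.I 1)
    have h4 := (fderiv ℂ (fderiv ℂ ψ) y 1).map_smul Complex.I 1
    rw [← h] at h3 h4
    rw [h3, _root_.smul_apply, h4, smul_smul, Complex.I_mul_I, neg_one_smul]
  rw [levi_apply, lap, fderiv_fderiv_comp hF hψ, fderiv_fderiv_comp hF hψ, h2]
  simp only [h1, smul_smul, Complex.I_mul_I, neg_one_smul, one_smul, map_neg]
  congr 1
  ring

/-- Read in the chart at `φ x`, this is `lap_comp`. It identifies the density of `φ^*(i∂∂̄f)` with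
half a Laplacian, the only place where harmonicity of the limit meets holomorphy of the disc. -/
theorem contDiffAt_comp_disc [CompleteSpace E] [IsManifold 𝓘(ℂ, E) ω M] {f : M → ℂ}
    (hf : ContMDiff 𝓘(ℝ, E) 𝓘(ℝ, ℂ) ∞ f) {φ : ℂ → M} {s : Set ℂ} (hs : IsOpen s)
    (hφ : MDifferentiableOn 𝓘(ℂ, ℂ) 𝓘(ℂ, E) φ s) {x : ℂ} (hx : x ∈ s) :
    ContDiffAt ℝ ∞ (f ∘ φ) x ∧ ddbarAt f (φ x) (discDeriv (E := E) φ x)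
      (Complex.I • discDeriv φ x) = (1 / 2 : ℝ) • lap (f ∘ φ) x := by
  have hd : ∀ x ∈ s, MDifferentiableAt 𝓘(ℂ, ℂ) 𝓘(ℂ, E) φ x := fun x hx =>
    hφ.mdifferentiableAt (hs.mem_nhds hx)
  have hsrc : ∀ᶠ y in 𝓝 x, φ y ∈ (chartAt E (φ x)).source :=
    (hd x hx).continuousAt.eventually
      ((chartAt E (φ x)).open_source.mem_nhds (mem_chart_source E (φ x)))
  have hdiff : ∀ᶠ y in 𝓝 x, DifferentiableAt ℂ (chartAt E (φ x) ∘ φ) y := by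
    filter_upwards [hsrc, hs.mem_nhds hx] with y hy hys
    exact differentiableAt_chart_comp (hd y hys) hy
  have han : AnalyticAt ℂ (chartAt E (φ x) ∘ φ) x :=
    Complex.analyticAt_iff_eventually_differentiableAt.2 hdiff
  have hψ : ContDiffAt ℂ ∞ (chartAt E (φ x) ∘ φ) x := han.contDiffAt
  have hF : ContDiffAt ℝ ∞ (f ∘ (chartAt E (φ x)).symm) ((chartAt E (φ x) ∘ φ) x) :=
    (contDiffOn_inChart hf (φ x)).contDiffAt
      ((chartAt E (φ x)).open_target.mem_nhds (mem_chart_target E (φ x)))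
  have hev : (f ∘ (chartAt E (φ x)).symm) ∘ (chartAt E (φ x) ∘ φ) =ᶠ[𝓝 x] f ∘ φ := by
    filter_upwards [hsrc] with y hy
    simp [(chartAt E (φ x)).left_inv hy]
  refine ⟨(hF.comp x (hψ.restrict_scalars ℝ)).congr_of_eventuallyEq hev.symm, ?_⟩
  have h := lap_comp (hF.of_le (by exact WithTop.coe_le_coe.2 le_top))
    (hψ.of_le (by exact WithTop.coe_le_coe.2 le_top))
  rw [discDeriv_eq_deriv φ (hd x hx), ddbarAt]
  refine h.trans ?_
  simp only [lap, hev.fderiv.fderiv_eq]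

end Charts

/-! ### Comparison of the Green weight `G_r` with `r - |x|` -/

section Green

/-- In polar coordinates the Jacobian `|x|` cancels the singularity. The function `|x|⁻¹` serves as
a majorant, independent of `r`, for the logarithmic pole of `G_r`. -/
theorem integrableOn_norm_inv (R : ℝ) : IntegrableOn (fun x : ℂ => ‖x‖⁻¹) (ball 0 R) := by
  have h : Integrable fun x : ℂ => (Set.Iio R).indicator (fun y : ℝ => y⁻¹) ‖x‖ := by
    refine (integrable_fun_norm_addHaar (volume : Measure ℂ)).2 ?_
    rw [Complex.finrank_real_complex]
    have h1 : IntegrableOn (fun _ : ℝ => (1 : ℝ)) (Set.Ioo 0 R) :=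
      integrableOn_const (by simp)
    refine IntegrableOn.of_forall_sdiff_eq_zero (s := Set.Ioo 0 R) ?_ measurableSet_Ioi ?_
    · refine h1.congr_fun (fun y hy => ?_) measurableSet_Ioo
      simp [Set.indicator_of_mem (show y ∈ Set.Iio R from hy.2), hy.1.ne']
    · intro y hy
      have : y ∉ Set.Iio R := fun h => hy.2 ⟨hy.1, h⟩
      simp [Set.indicator_of_notMem this]
  refine h.integrableOn.congr_fun (fun x hx => ?_) measurableSet_ball
  have : ‖x‖ ∈ Set.Iio R := mem_ball_zero_iff.1 hx
  simp [Set.indicator_of_mem this]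

theorem measurable_green (r : ℝ) : Measurable (green r) :=
  (Real.continuous_posLog.measurable.comp (measurable_const.div measurable_norm)).const_mul _

theorem green_nonneg (r : ℝ) (x : ℂ) : 0 ≤ green r x :=
  mul_nonneg (by positivity) Real.posLog_nonneg

theorem green_eq_zero {r : ℝ} (hr : 0 ≤ r) {x : ℂ} (hx : r ≤ ‖x‖) : green r x = 0 := by
  have : Real.posLog (r / ‖x‖) = 0 := by
    rw [Real.posLog_eq_zero_iff, abs_of_nonneg (by positivity)]
    exact div_le_one_of_le₀ hx (norm_nonneg _)
  rw [green, this, mul_zero]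

theorem green_eq_log {r : ℝ} {x : ℂ} (hx0 : x ≠ 0) (hx : ‖x‖ ≤ r) :
    green r x = (2 * Real.pi)⁻¹ * Real.log (r / ‖x‖) := by
  have h : 0 < ‖x‖ := norm_pos_iff.2 hx0
  rw [green, Real.posLog_eq_log]
  rw [abs_of_nonneg (div_nonneg (h.le.trans hx) h.le), le_div_iff₀ h, one_mul]
  exact hx

theorem green_le_norm_inv {r : ℝ} (hr : 0 ≤ r) (hr1 : r ≤ 1) (x : ℂ) : green r x ≤ ‖x‖⁻¹ := by
  rcases lt_or_ge ‖x‖ r with hx | hx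
  · rcases eq_or_ne x 0 with rfl | h0
    · simp [green]
    have h : 0 < ‖x‖ := norm_pos_iff.2 h0
    rw [green_eq_log h0 hx.le]
    have h1 : Real.log (r / ‖x‖) ≤ r / ‖x‖ - 1 := Real.log_le_sub_one_of_pos (by
      have := h.trans hx
      positivity)
    have h2 : r / ‖x‖ ≤ ‖x‖⁻¹ := by
      rw [div_eq_mul_inv]
      exact mul_le_of_le_one_left (by positivity) hr1
    have h3 : (2 * Real.pi)⁻¹ ≤ 1 := inv_le_one_of_one_le₀ (by linarith [Real.pi_gt_three])
    calc (2 * Real.pi)⁻¹ * Real.log (r / ‖x‖) ≤ (2 * Real.pi)⁻¹ * ‖x‖⁻¹ := by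
          gcongr
          linarith
      _ ≤ ‖x‖⁻¹ := mul_le_of_le_one_left (by positivity) h3
  · rw [green_eq_zero hr hx]
    positivity

/-- From `log t ≤ t - 1` the weight is at most `(r - |x|) / |x|`, and away from the pole `1 / |x| ≤
4`. -/
theorem green_le_of_quarter_le {r : ℝ} (hr : 0 ≤ r) {x : ℂ} (hx : 1 / 4 ≤ ‖x‖) :
    green r x ≤ 4 * max (r - ‖x‖) 0 := by
  rcases lt_or_ge ‖x‖ r with h | h
  · have h0 : 0 < ‖x‖ := by linarith
    rw [green_eq_log (norm_pos_iff.1 h0) h.le, max_eq_left (by linarith)]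
    have h1 : Real.log (r / ‖x‖) ≤ r / ‖x‖ - 1 := Real.log_le_sub_one_of_pos (by
      have := h0.trans h
      positivity)
    have h2 : r / ‖x‖ - 1 ≤ 4 * (r - ‖x‖) := by
      rw [div_sub_one h0.ne', div_le_iff₀ h0]
      nlinarith
    have h3 : (2 * Real.pi)⁻¹ ≤ 1 := inv_le_one_of_one_le₀ (by linarith [Real.pi_gt_three])
    calc (2 * Real.pi)⁻¹ * Real.log (r / ‖x‖) ≤ (2 * Real.pi)⁻¹ * (4 * (r - ‖x‖)) := by
          gcongr
          linarith
      _ ≤ 4 * (r - ‖x‖) := mul_le_of_le_one_left (by linarith) h3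
  · rw [green_eq_zero hr h]
    positivity

/-- From `log t ≥ 1 - 1 / t` the logarithm is at least `(r - |x|) / r`, and `r < 1`. The origin is
excluded because division by zero gives `green r 0 = 0` instead of `+∞`. -/
theorem le_green {r : ℝ} (hr : r ∈ Set.Ioo (0 : ℝ) 1) {x : ℂ} (hx : x ≠ 0) :
    (2 * Real.pi)⁻¹ * max (r - ‖x‖) 0 ≤ green r x := by
  rcases lt_or_ge ‖x‖ r with h | h
  · have h0 : 0 < ‖x‖ := norm_pos_iff.2 hx
    rw [green_eq_log hx h.le, max_eq_left (by linarith)]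
    have h1 : 1 - (r / ‖x‖)⁻¹ ≤ Real.log (r / ‖x‖) := Real.one_sub_inv_le_log_of_pos (by
      have := hr.1
      positivity)
    have h2 : r - ‖x‖ ≤ 1 - (r / ‖x‖)⁻¹ := by
      rw [inv_div, one_sub_div hr.1.ne', le_div_iff₀ hr.1]
      nlinarith [hr.2]
    gcongr
    exact h2.trans h1
  · rw [max_eq_right (by linarith), mul_zero]
    exact green_nonneg r x

/-- A function on the unit disc, continuous and vanishing near the boundary, is integrable. -/
theorem integrableOn_ball_of_eq_zero {F : Type*} [NormedAddCommGroup F] {h : ℂ → F} {r : ℝ}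
    (hr : r < 1) (hc : ContinuousOn h (ball 0 1)) (h0 : ∀ x, r ≤ ‖x‖ → h x = 0) :
    IntegrableOn h (ball 0 1) := by
  have h1 : IntegrableOn h (closedBall 0 r) :=
    (hc.mono (closedBall_subset_ball hr)).integrableOn_compact (isCompact_closedBall 0 r)
  refine h1.of_forall_sdiff_eq_zero measurableSet_ball fun x hx => h0 x ?_
  have := hx.2
  rw [mem_closedBall_zero_iff, not_le] at this
  exact this.le

theorem integrableOn_green_mul {𝕜 : Type*} [RCLike 𝕜] {h : ℂ → 𝕜} (hc : ContinuousOn h (ball 0 1))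
    {r : ℝ} (hr : r ∈ Set.Ioo (0 : ℝ) 1) :
    IntegrableOn (fun x => (green r x : 𝕜) * h x) (ball 0 1) := by
  obtain ⟨C, hC⟩ := (isCompact_closedBall (0 : ℂ) r).exists_bound_of_continuousOn
    (hc.mono (closedBall_subset_ball hr.2))
  refine Integrable.mono' ((integrableOn_norm_inv 1).mul_const C) ?_ ?_
  · exact (RCLike.continuous_ofReal.measurable.comp (measurable_green r)).aestronglyMeasurable.mul
      (hc.aestronglyMeasurable measurableSet_ball)
  · refine Eventually.of_forall fun x => ?_
    rw [norm_mul, RCLike.norm_ofReal, abs_of_nonneg (green_nonneg r x)]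
    rcases le_or_gt ‖x‖ r with hx | hx
    · have := hC x (mem_closedBall_zero_iff.2 hx)
      have := green_le_norm_inv hr.1.le hr.2.le x
      gcongr
    · have hC0 : 0 ≤ C := (norm_nonneg _).trans (hC 0 (mem_closedBall_self hr.1.le))
      rw [green_eq_zero hr.1.le hx.le, zero_mul]
      positivity

/-- The total mass of `(r - |x|) q(x)` on the disc of radius `r`. -/
def weightedMass (q : ℂ → ℝ) (r : ℝ) : ℝ := ∫ x in ball (0 : ℂ) r, (r - ‖x‖) * q x

/-- Truncating the weight moves the dependence on `r` from the domain to the integrand, where it is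
monotone. -/
theorem weightedMass_eq (q : ℂ → ℝ) {r : ℝ} (hr : r < 1) :
    weightedMass q r = ∫ x in ball (0 : ℂ) 1, max (r - ‖x‖) 0 * q x := by
  rw [weightedMass, setIntegral_eq_of_subset_of_forall_sdiff_eq_zero (s := ball (0 : ℂ) r)
    measurableSet_ball (ball_subset_ball hr.le)]
  · refine setIntegral_congr_fun measurableSet_ball fun x hx => ?_
    rw [mem_ball_zero_iff] at hx
    simp only [max_eq_left (sub_nonneg.2 hx.le)]
  · intro x hx
    have := hx.2
    rw [mem_ball_zero_iff, not_lt] at this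
    rw [max_eq_right (by linarith), zero_mul]

theorem integrableOn_weight {q : ℂ → ℝ} (hq : ContinuousOn q (ball 0 1)) {r : ℝ} (hr : r < 1) :
    IntegrableOn (fun x => max (r - ‖x‖) 0 * q x) (ball 0 1) := by
  refine integrableOn_ball_of_eq_zero hr (ContinuousOn.mul (by fun_prop) hq) fun x hx => ?_
  rw [max_eq_right (by linarith), zero_mul]

variable {q : ℂ → ℝ}

theorem weightedMass_nonneg (hq0 : ∀ x, 0 ≤ q x) {r : ℝ} (hr : r < 1) : 0 ≤ weightedMass q r := by
  rw [weightedMass_eq q hr]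
  exact integral_nonneg fun x => mul_nonneg (le_max_right _ _) (hq0 x)

theorem weightedMass_mono (hq : ContinuousOn q (ball 0 1)) (hq0 : ∀ x, 0 ≤ q x) {r r' : ℝ}
    (hr : r ≤ r') (hr' : r' < 1) : weightedMass q r ≤ weightedMass q r' := by
  rw [weightedMass_eq q (hr.trans_lt hr'), weightedMass_eq q hr']
  refine setIntegral_mono_on (integrableOn_weight hq (hr.trans_lt hr'))
    (integrableOn_weight hq hr') measurableSet_ball fun x _ => ?_
  have := hq0 x
  gcongr

/-- Monotone convergence along a sequence increasing to `1` gives divergence along that sequence;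
monotonicity in `r` extends it to the whole left neighbourhood filter. -/
theorem tendsto_weightedMass (hq : ContinuousOn q (ball 0 1)) (hq0 : ∀ x, 0 ≤ q x)
    (hinf : ∫⁻ x in ball (0 : ℂ) 1, ENNReal.ofReal ((1 - ‖x‖) * q x) = ⊤) :
    Tendsto (weightedMass q) (𝓝[<] 1) atTop := by
  obtain ⟨ρ, hρm, hρ1, hρ⟩ := exists_seq_strictMono_tendsto (1 : ℝ)
  have hlim : Tendsto (fun n => ∫⁻ x in ball (0 : ℂ) 1, ENNReal.ofReal (max (ρ n - ‖x‖) 0 * q x))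
      atTop (𝓝 (∫⁻ x in ball (0 : ℂ) 1, ENNReal.ofReal ((1 - ‖x‖) * q x))) := by
    refine lintegral_tendsto_of_tendsto_of_monotone (fun n => ?_) ?_ ?_
    · exact (integrableOn_weight hq (hρ1 n)).aemeasurable.ennreal_ofReal
    · refine Eventually.of_forall fun x m n hmn => ENNReal.ofReal_le_ofReal ?_
      have := hq0 x
      have := hρm.monotone hmn
      gcongr
    · refine (ae_restrict_iff' measurableSet_ball).2 (Eventually.of_forall fun x hx => ?_)
      rw [mem_ball_zero_iff] at hx
      have h1 : Tendsto (fun n => max (ρ n - ‖x‖) 0 * q x) atTop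
          (𝓝 (max (1 - ‖x‖) 0 * q x)) :=
        ((hρ.sub_const _).max tendsto_const_nhds).mul_const _
      rw [max_eq_left (by linarith)] at h1
      exact ENNReal.tendsto_ofReal h1
  rw [hinf] at hlim
  have h2 : Tendsto (fun n => weightedMass q (ρ n)) atTop atTop := by
    rw [← ENNReal.tendsto_ofReal_nhds_top]
    refine hlim.congr fun n => ?_
    rw [weightedMass_eq q (hρ1 n), ofReal_integral_eq_lintegral_ofReal
      (integrableOn_weight hq (hρ1 n))]
    exact Eventually.of_forall fun x => mul_nonneg (le_max_right _ _) (hq0 x)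
  refine tendsto_atTop.2 fun R => ?_
  obtain ⟨n, hn⟩ := (h2.eventually_ge_atTop R).exists
  filter_upwards [Ioo_mem_nhdsLT (hρ1 n)] with r hr
  exact hn.trans (weightedMass_mono hq hq0 hr.1.le hr.2)

theorem weightedMass_le_integral_green (hq : ContinuousOn q (ball 0 1)) (hq0 : ∀ x, 0 ≤ q x)
    {r : ℝ} (hr : r ∈ Set.Ioo (0 : ℝ) 1) :
    (2 * Real.pi)⁻¹ * weightedMass q r ≤ ∫ x in ball (0 : ℂ) 1, green r x * q x := by
  rw [weightedMass_eq q hr.2, ← integral_const_mul]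
  refine setIntegral_mono_ae ((integrableOn_weight hq hr.2).const_mul _)
    (integrableOn_green_mul (𝕜 := ℝ) hq hr) ?_
  filter_upwards [compl_mem_ae_iff.2 (measure_singleton (0 : ℂ))] with x hx
  rw [← mul_assoc]
  have := hq0 x
  have := le_green hr (x := x) hx
  gcongr

/-- The pole and the boundary are separated at `|x| = 1/4`. Inside, `G_r ≤ |x|⁻¹` contributes a
fixed constant `C₀`; outside, `G_r ≤ 4 (r - |x|)`. Once the weighted mass exceeds `1`, which
divergence guarantees near `r = 1`, `C₀` is absorbed into the multiple of the mass. -/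
theorem exists_integral_green_le (hq : ContinuousOn q (ball 0 1)) (hq0 : ∀ x, 0 ≤ q x)
    (hinf : ∫⁻ x in ball (0 : ℂ) 1, ENNReal.ofReal ((1 - ‖x‖) * q x) = ⊤) :
    ∃ K, 0 ≤ K ∧ ∀ᶠ r in 𝓝[<] (1 : ℝ),
      ∫ x in ball (0 : ℂ) 1, green r x * q x ≤ K * weightedMass q r := by
  obtain ⟨C, hC⟩ := (isCompact_closedBall (0 : ℂ) (1 / 4)).exists_bound_of_continuousOn
    (hq.mono (closedBall_subset_ball (by norm_num)))
  have hC0 : 0 ≤ C := (norm_nonneg _).trans (hC 0 (mem_closedBall_self (by norm_num)))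
  set C₀ := ∫ x in ball (0 : ℂ) 1, ‖x‖⁻¹ * C with hC₀
  have hC₀0 : 0 ≤ C₀ := integral_nonneg fun x => by positivity
  refine ⟨C₀ + 4, by positivity, ?_⟩
  filter_upwards [Ioo_mem_nhdsLT (zero_lt_one' ℝ),
    (tendsto_weightedMass hq hq0 hinf).eventually_ge_atTop 1] with r hr h1
  have hi1 := (integrableOn_norm_inv 1).mul_const C
  have hi2 := (integrableOn_weight hq hr.2).const_mul 4
  calc ∫ x in ball (0 : ℂ) 1, green r x * q x
      ≤ ∫ x in ball (0 : ℂ) 1, (‖x‖⁻¹ * C + 4 * (max (r - ‖x‖) 0 * q x)) := by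
        refine setIntegral_mono_on (integrableOn_green_mul (𝕜 := ℝ) hq hr) (hi1.add hi2)
          measurableSet_ball fun x _ => ?_
        have hx0 := hq0 x
        rcases le_or_gt ‖x‖ (1 / 4) with hx | hx
        · have h2 : q x ≤ C := (le_abs_self _).trans (hC x (mem_closedBall_zero_iff.2 hx))
          have h3 := green_le_norm_inv hr.1.le hr.2.le x
          have h4 : 0 ≤ 4 * (max (r - ‖x‖) 0 * q x) := by positivity
          have h5 : green r x * q x ≤ ‖x‖⁻¹ * C := by gcongr
          linarith
        · have h3 := green_le_of_quarter_le hr.1.le hx.le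
          have h4 : 0 ≤ ‖x‖⁻¹ * C := by positivity
          have h5 : green r x * q x ≤ (4 * max (r - ‖x‖) 0) * q x := by gcongr
          linarith
    _ = C₀ + 4 * weightedMass q r := by
        rw [integral_add hi1 hi2, weightedMass_eq q hr.2, integral_const_mul]
    _ ≤ (C₀ + 4) * weightedMass q r := by nlinarith

theorem exists_norm_integral_green_le {h : ℂ → ℂ} (hc : ContinuousOn h (closedBall 0 (1 / 4))) :
    ∃ C, ∀ r ∈ Set.Ioo (0 : ℝ) 1, ‖∫ x in closedBall (0 : ℂ) (1 / 4), (green r x : ℂ) * h x‖ ≤ C := by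
  obtain ⟨C, hC⟩ := (isCompact_closedBall (0 : ℂ) (1 / 4)).exists_bound_of_continuousOn hc
  have hi : IntegrableOn (fun x : ℂ => ‖x‖⁻¹ * C) (closedBall 0 (1 / 4)) :=
    IntegrableOn.mono_set (t := ball 0 1) ((integrableOn_norm_inv 1).mul_const C)
      (closedBall_subset_ball (by norm_num))
  refine ⟨∫ x in closedBall (0 : ℂ) (1 / 4), ‖x‖⁻¹ * C, fun r hr => ?_⟩
  refine norm_integral_le_of_norm_le hi ((ae_restrict_iff' measurableSet_closedBall).2
    (Eventually.of_forall fun x hx => ?_))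
  rw [norm_mul, Complex.norm_real, Real.norm_of_nonneg (green_nonneg r x)]
  have := hC x hx
  have := green_le_norm_inv hr.1.le hr.2.le x
  gcongr

end Green

/-! ### Jensen's formula and the uniform bound for Laplacians -/

section Jensen

open Complex in
theorem hasDerivAt_exp_mul_I (θ : ℝ) :
    HasDerivAt (fun θ : ℝ => exp (θ * I)) (I * exp (θ * I)) θ := by
  have h : HasDerivAt (fun θ : ℝ => (θ : ℂ) * I) I θ := by
    simpa using (hasDerivAt_id θ).ofReal_comp.mul_const I
  simpa [mul_comm] using h.cexp

theorem hasDerivAt_integral_of_continuous {f f' : ℝ → ℝ → ℂ} (hf : Continuous f.uncurry)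
    (hf' : Continuous f'.uncurry) (hd : ∀ s t, HasDerivAt (fun s => f s t) (f' s t) s)
    (a b s : ℝ) :
    HasDerivAt (fun s => ∫ t in a..b, f s t) (∫ t in a..b, f' s t) s := by
  obtain ⟨C, hC⟩ := ((isCompact_Icc (a := s - 1) (b := s + 1)).prod
    (isCompact_uIcc (a := a) (b := b))).exists_bound_of_continuousOn hf'.continuousOn
  refine (intervalIntegral.hasDerivAt_integral_of_dominated_loc_of_deriv_le (F := f) (F' := f')
    (bound := fun _ => C) (Icc_mem_nhds (sub_one_lt s) (lt_add_one s)) ?_ ?_ ?_ ?_ ?_ ?_).2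
  · exact Eventually.of_forall fun s => (hf.uncurry_left s).aestronglyMeasurable
  · exact (hf.uncurry_left s).intervalIntegrable _ _
  · exact (hf'.uncurry_left s).aestronglyMeasurable
  · exact Eventually.of_forall fun t ht x hx => hC (x, t) ⟨hx, Set.uIoc_subset_uIcc ht⟩
  · exact intervalIntegrable_const
  · exact Eventually.of_forall fun t _ x _ => hd x t

/-- The circle integral `∫ U(s e^{iθ}) dθ`. -/
def circInt (U : ℂ → ℂ) (s : ℝ) : ℂ :=
  ∫ θ in -Real.pi..Real.pi, U (s * Complex.exp (θ * Complex.I))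

/-- The integral over the circle of radius `s` of the radial derivative of `U`. -/
def circIntRadial (U : ℂ → ℂ) (s : ℝ) : ℂ :=
  ∫ θ in -Real.pi..Real.pi, fderiv ℝ U (s * Complex.exp (θ * Complex.I))
    (Complex.exp (θ * Complex.I))

theorem continuous_lap {U : ℂ → ℂ} (hU : ContDiff ℝ 2 U) : Continuous (lap U) := by
  have h2 : Continuous (fderiv ℝ (fderiv ℝ U)) :=
    (hU.fderiv_right (m := 1) (by norm_num)).continuous_fderiv (by norm_num)
  unfold lap
  fun_prop

/-- The trace of a bilinear form is the same in every orthonormal basis, here `e^{iθ}, i e^{iθ}`. -/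
theorem bilin_rotate (B : ℂ →L[ℝ] ℂ →L[ℝ] ℂ) (θ : ℝ) :
    B (Complex.exp (θ * Complex.I)) (Complex.exp (θ * Complex.I))
      + B (Complex.I * Complex.exp (θ * Complex.I)) (Complex.I * Complex.exp (θ * Complex.I))
      = B 1 1 + B Complex.I Complex.I := by
  have h1 : Complex.exp (θ * Complex.I) = Real.cos θ • (1 : ℂ) + Real.sin θ • Complex.I := by
    rw [Complex.exp_mul_I]
    simp
  have h2 : Complex.I * Complex.exp (θ * Complex.I)
      = (-Real.sin θ) • (1 : ℂ) + Real.cos θ • Complex.I := by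
    rw [h1]
    simp only [Complex.real_smul, Complex.ofReal_neg]
    linear_combination (Real.sin θ : ℂ) * Complex.I_mul_I
  have h3 : (Real.cos θ : ℂ) ^ 2 + (Real.sin θ : ℂ) ^ 2 = 1 := by
    exact_mod_cast Real.cos_sq_add_sin_sq θ
  rw [h2, h1]
  simp only [map_add, map_smul, _root_.add_apply, _root_.smul_apply]
  simp only [Complex.real_smul, Complex.ofReal_neg]
  linear_combination (B 1 1 + B Complex.I Complex.I) * h3

section

variable {U : ℂ → ℂ} (hU : ContDiff ℝ 2 U)
include hU

theorem hasDerivAt_circInt (s : ℝ) : HasDerivAt (circInt U) (circIntRadial U s) s := by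
  have h0 := hU.continuous
  have h1 : Continuous (fderiv ℝ U) := hU.continuous_fderiv (by norm_num)
  refine hasDerivAt_integral_of_continuous
    (f := fun s θ : ℝ => U (s * Complex.exp (θ * Complex.I)))
    (f' := fun s θ : ℝ => fderiv ℝ U (s * Complex.exp (θ * Complex.I))
      (Complex.exp (θ * Complex.I))) ?_ ?_ (fun s t => ?_) _ _ s
  · simp only [Function.uncurry_def]
    fun_prop
  · simp only [Function.uncurry_def]
    fun_prop
  · have h2 : HasDerivAt (fun s : ℝ => (s : ℂ) * Complex.exp (t * Complex.I))
        (Complex.exp (t * Complex.I)) s := by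
      simpa using (hasDerivAt_id s).ofReal_comp.mul_const (Complex.exp (t * Complex.I))
    exact ((hU.differentiable (by norm_num)) _).hasFDerivAt.comp_hasDerivAt s h2

/-- In polar coordinates `s ΔU = ∂_s (s ∂_s U) + s⁻¹ ∂_θ² U`, and the last term integrates to zero
over a full circle. -/
theorem hasDerivAt_mul_circIntRadial (s : ℝ) :
    HasDerivAt (fun s : ℝ => (s : ℂ) * circIntRadial U s) (s * circInt (lap U) s) s := by
  have h1 : Continuous (fderiv ℝ U) := hU.continuous_fderiv (by norm_num)
  have hU1 : ContDiff ℝ 1 (fderiv ℝ U) := hU.fderiv_right (m := 1) (by norm_num)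
  have h2 : Continuous (fderiv ℝ (fderiv ℝ U)) := hU1.continuous_fderiv (by norm_num)
  have hd2 : ∀ x, HasFDerivAt (fderiv ℝ U) (fderiv ℝ (fderiv ℝ U) x) x := fun x =>
    ((hU1.differentiable (by norm_num)) x).hasFDerivAt
  have key := hasDerivAt_integral_of_continuous
    (f := fun s θ : ℝ => fderiv ℝ U (s * Complex.exp (θ * Complex.I))
      (s * Complex.exp (θ * Complex.I)))
    (f' := fun s θ : ℝ => fderiv ℝ (fderiv ℝ U) (s * Complex.exp (θ * Complex.I))
      (Complex.exp (θ * Complex.I)) (s * Complex.exp (θ * Complex.I))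
      + fderiv ℝ U (s * Complex.exp (θ * Complex.I)) (Complex.exp (θ * Complex.I)))
    (by simp only [Function.uncurry_def]; fun_prop)
    (by simp only [Function.uncurry_def]; fun_prop)
    (fun s t => by
      have h3 : HasDerivAt (fun s : ℝ => (s : ℂ) * Complex.exp (t * Complex.I))
          (Complex.exp (t * Complex.I)) s := by
        simpa using (hasDerivAt_id s).ofReal_comp.mul_const (Complex.exp (t * Complex.I))
      exact ((hd2 _).comp_hasDerivAt s h3).clm_apply h3) (-Real.pi) Real.pi s
  -- The integrand is the `θ`-derivative of the periodic function `U'(s e^{iθ})(i e^{iθ})`, which is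
  -- `s⁻¹ ∂_θ U` written without dividing by `s`.
  have hper : ∫ θ in -Real.pi..Real.pi,
      (fderiv ℝ (fderiv ℝ U) (s * Complex.exp (θ * Complex.I))
        (s * (Complex.I * Complex.exp (θ * Complex.I))) (Complex.I * Complex.exp (θ * Complex.I))
      + fderiv ℝ U (s * Complex.exp (θ * Complex.I))
        (Complex.I * (Complex.I * Complex.exp (θ * Complex.I)))) = 0 := by
    rw [intervalIntegral.integral_eq_sub_of_hasDerivAt
      (f := fun θ : ℝ => fderiv ℝ U (s * Complex.exp (θ * Complex.I))
        (Complex.I * Complex.exp (θ * Complex.I)))]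
    · simp [Complex.exp_neg]
    · intro θ _
      exact ((hd2 _).comp_hasDerivAt θ ((hasDerivAt_exp_mul_I θ).const_mul (s : ℂ))).clm_apply
        ((hasDerivAt_exp_mul_I θ).const_mul Complex.I)
    · exact Continuous.intervalIntegrable (by fun_prop) _ _
  have hval : ∫ θ in -Real.pi..Real.pi,
      (fderiv ℝ (fderiv ℝ U) (s * Complex.exp (θ * Complex.I))
        (Complex.exp (θ * Complex.I)) (s * Complex.exp (θ * Complex.I))
      + fderiv ℝ U (s * Complex.exp (θ * Complex.I)) (Complex.exp (θ * Complex.I)))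
      = s * circInt (lap U) s := by
    rw [← add_zero (∫ θ in -Real.pi..Real.pi, _), ← hper, ← intervalIntegral.integral_add
      (Continuous.intervalIntegrable (by fun_prop) _ _)
      (Continuous.intervalIntegrable (by fun_prop) _ _), circInt,
      ← intervalIntegral.integral_const_mul]
    refine intervalIntegral.integral_congr fun θ _ => ?_
    have e1 : Complex.I * (Complex.I * Complex.exp (θ * Complex.I))
        = -Complex.exp (θ * Complex.I) := by
      rw [← mul_assoc, Complex.I_mul_I, neg_one_mul]
    have e2 := bilin_rotate (fderiv ℝ (fderiv ℝ U) (s * Complex.exp (θ * Complex.I))) θ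
    simp only [e1, map_neg, lap, ← e2]
    simp only [← Complex.real_smul, map_smul, _root_.smul_apply]
    rw [smul_add]
    ring
  rw [hval] at key
  refine key.congr_of_eventuallyEq (Eventually.of_forall fun s => ?_)
  simp only [circIntRadial]
  rw [← intervalIntegral.integral_const_mul]
  refine intervalIntegral.integral_congr fun θ _ => ?_
  simp only [← Complex.real_smul, map_smul]

/-- With `c` the circle integral of `U`, the function `log (r / s) s c'(s) + c(s)` is a primitive:
the derivative of the logarithm produces `-c'(s)`, which cancels the derivative of `c`. At `s = r`
the logarithmic term vanishes. -/
theorem integral_log_mul_circInt_lap {a r : ℝ} (ha : 0 < a) (har : a ≤ r) :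
    ∫ s in a..r, (Real.log (r / s) : ℂ) * (s * circInt (lap U) s)
      = circInt U r - circInt U a - Real.log (r / a) * (a * circIntRadial U a) := by
  have hr : 0 < r := ha.trans_le har
  rw [intervalIntegral.integral_eq_sub_of_hasDerivAt
    (f := fun s : ℝ => (Real.log (r / s) : ℂ) * (s * circIntRadial U s) + circInt U s)]
  · rw [div_self hr.ne']
    simp only [Real.log_one, Complex.ofReal_zero]
    ring
  · intro s hs
    rw [Set.uIcc_of_le har] at hs
    have hs0 : 0 < s := ha.trans_le hs.1
    have h1 : HasDerivAt (fun s : ℝ => Real.log (r / s)) (-s⁻¹) s := by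
      have := ((hasDerivAt_inv hs0.ne').const_mul r).log (by positivity)
      refine this.congr_deriv ?_
      field_simp
    have h2 := (h1.ofReal_comp.mul (hasDerivAt_mul_circIntRadial hU s)).add
      (hasDerivAt_circInt hU s)
    refine h2.congr_deriv ?_
    have : (s : ℂ) ≠ 0 := by exact_mod_cast hs0.ne'
    push_cast
    field_simp
    ring
  · refine ContinuousOn.intervalIntegrable ?_
    rw [Set.uIcc_of_le har]
    have hc : Continuous (circInt (lap U)) := by
      have := continuous_lap hU
      unfold circInt
      fun_prop
    refine ContinuousOn.mul ?_ (by fun_prop)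
    refine Complex.continuous_ofReal.comp_continuousOn (ContinuousOn.log ?_ ?_)
    · exact continuousOn_const.div continuousOn_id fun s hs => (ha.trans_le hs.1).ne'
    · exact fun s hs => (div_pos hr (ha.trans_le hs.1)).ne'

/-- Polar coordinates reduce this to the radial formula. Staying on an annulus avoids the pole, at
the cost of a term with the radial derivative on the inner circle. -/
theorem integral_annulus_green_mul_lap {a r : ℝ} (ha : 0 < a) (har : a ≤ r) :
    ∫ x in {x : ℂ | ‖x‖ ∈ Set.Ioc a r}, (green r x : ℂ) * lap U x
      = (2 * Real.pi : ℂ)⁻¹ * (circInt U r - circInt U a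
        - Real.log (r / a) * (a * circIntRadial U a)) := by
  have hr : 0 < r := ha.trans_le har
  have hlap := continuous_lap hU
  have hmeas : MeasurableSet {x : ℂ | ‖x‖ ∈ Set.Ioc a r} := measurable_norm measurableSet_Ioc
  set G : ℝ × ℝ → ℂ := fun p => (2 * Real.pi : ℂ)⁻¹ * (Real.log (r / p.1) * (p.1 *
    lap U (p.1 * Complex.exp (p.2 * Complex.I)))) with hG
  have hGc : ContinuousOn G (Set.Icc a r ×ˢ Set.Icc (-Real.pi) Real.pi) := by
    refine continuousOn_const.mul (ContinuousOn.mul ?_ (by fun_prop))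
    refine Complex.continuous_ofReal.comp_continuousOn (ContinuousOn.log ?_ ?_)
    · exact continuousOn_const.div continuousOn_fst fun s hs => (ha.trans_le hs.1.1).ne'
    · exact fun s hs => (div_pos hr (ha.trans_le hs.1.1)).ne'
  have hGi : IntegrableOn G (Set.Ioc a r ×ˢ Set.Ioc (-Real.pi) Real.pi) :=
    (hGc.integrableOn_compact (isCompact_Icc.prod isCompact_Icc)).mono_set
      (Set.prod_mono Set.Ioc_subset_Icc_self Set.Ioc_subset_Icc_self)
  rw [← integral_indicator hmeas, ← Complex.integral_comp_polarCoord_symm]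
  have h1 : ∀ p ∈ polarCoord.target, p.1 • ({x : ℂ | ‖x‖ ∈ Set.Ioc a r}.indicator
      (fun x => (green r x : ℂ) * lap U x) (Complex.polarCoord.symm p))
      = (Set.Ioc a r ×ˢ Set.Ioo (-Real.pi) Real.pi).indicator G p := by
    intro p hp
    rw [polarCoord_target] at hp
    have hp1 : 0 < p.1 := hp.1
    have hn : ‖Complex.polarCoord.symm p‖ = p.1 := by
      rw [Complex.norm_polarCoord_symm, abs_of_pos hp1]
    have he : Complex.polarCoord.symm p = p.1 * Complex.exp (p.2 * Complex.I) := by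
      rw [Complex.polarCoord_symm_apply, Complex.exp_mul_I]
      simp
    by_cases h : p.1 ∈ Set.Ioc a r
    · have hm : Complex.polarCoord.symm p ∈ {x : ℂ | ‖x‖ ∈ Set.Ioc a r} := by
        rwa [Set.mem_ofPred_eq, hn]
      rw [Set.indicator_of_mem (show p ∈ Set.Ioc a r ×ˢ Set.Ioo (-Real.pi) Real.pi from ⟨h, hp.2⟩),
        Set.indicator_of_mem hm,
        green_eq_log (norm_pos_iff.1 (by rwa [hn])) (by rw [hn]; exact h.2), hn, he, hG]
      rw [Complex.real_smul]
      push_cast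
      ring
    · have hm : Complex.polarCoord.symm p ∉ {x : ℂ | ‖x‖ ∈ Set.Ioc a r} := by
        rwa [Set.mem_ofPred_eq, hn]
      rw [Set.indicator_of_notMem hm, Set.indicator_of_notMem (fun hh => h hh.1), smul_zero]
  have hsub : Set.Ioc a r ×ˢ Set.Ioo (-Real.pi) Real.pi ⊆ polarCoord.target := by
    rw [polarCoord_target]
    exact Set.prod_mono (fun s hs => ha.trans hs.1) subset_rfl
  rw [setIntegral_congr_fun polarCoord.open_target.measurableSet h1,
    setIntegral_indicator (measurableSet_Ioc.prod measurableSet_Ioo),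
    Set.inter_eq_self_of_subset_right hsub, Measure.volume_eq_prod, setIntegral_prod]
  · rw [← integral_log_mul_circInt_lap hU ha har, intervalIntegral.integral_of_le har,
      ← integral_const_mul]
    refine setIntegral_congr_fun measurableSet_Ioc fun s _ => ?_
    simp only [hG]
    rw [circInt, intervalIntegral.integral_of_le (by linarith [Real.pi_pos]),
      integral_Ioc_eq_integral_Ioo, integral_const_mul, integral_const_mul, integral_const_mul]
  · exact hGi.mono_set (Set.prod_mono subset_rfl Set.Ioo_subset_Ioc_self)

end

theorem norm_circInt_le {U : ℂ → ℂ} {C s : ℝ} (hs : 0 ≤ s) (hC : ∀ x, ‖x‖ = s → ‖U x‖ ≤ C) :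
    ‖circInt U s‖ ≤ C * (2 * Real.pi) := by
  refine (intervalIntegral.norm_integral_le_of_norm_le_const fun θ _ => hC _ ?_).trans_eq ?_
  · rw [norm_mul, Complex.norm_exp_ofReal_mul_I, Complex.norm_real, Real.norm_of_nonneg hs, mul_one]
  · rw [abs_of_nonneg] <;> linarith [Real.pi_pos]

/-- The integral of the Laplacian of a bounded smooth function on the unit disc against the weights
`G_r` stays bounded. -/
theorem exists_norm_integral_green_mul_lap_le {U : ℂ → ℂ}
    (hU : ∀ x ∈ ball (0 : ℂ) 1, ContDiffAt ℝ ∞ U x) {C : ℝ} (hC : ∀ x, ‖U x‖ ≤ C) :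
    ∃ C', ∀ r ∈ Set.Ioo (1 / 4 : ℝ) 1, ‖∫ x in ball (0 : ℂ) 1, (green r x : ℂ) * lap U x‖ ≤ C' := by
  have hlap : ContinuousOn (lap U) (ball 0 1) := by
    intro x hx
    have h1 : ContinuousAt (fderiv ℝ (fderiv ℝ U)) x :=
      (((hU x hx).fderiv_right (m := ∞) (by simp)).fderiv_right (m := ∞) (by simp)).continuousAt
    exact ContinuousAt.continuousWithinAt
      (((h1.clm_apply continuousAt_const).clm_apply continuousAt_const).add
        ((h1.clm_apply continuousAt_const).clm_apply continuousAt_const))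
  obtain ⟨C₁, hC₁⟩ := exists_norm_integral_green_le
    (hlap.mono (closedBall_subset_ball (by norm_num : (1 / 4 : ℝ) < 1)))
  set P := ‖circIntRadial U (1 / 4)‖ with hP
  -- `C₁` bounds the part near the pole, each of the two circle integrals is at most `2π C`, and
  -- `log (4r) ≤ 4r - 1 ≤ 3` multiplies the derivative term. That term lives on the fixed circle of
  -- radius `1/4`, so it does not depend on `r`.
  refine ⟨C₁ + (2 * (C * (2 * Real.pi)) + 3 * P), fun r hr => ?_⟩
  have hr0 : r ∈ Set.Ioo (0 : ℝ) 1 := ⟨by linarith [hr.1], hr.2⟩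
  -- `U` is smooth only inside the disc. The cut-off is `1` beyond radius `r` and vanishes before
  -- radius `1`, so `V` is smooth on the whole plane and agrees with `U` near the closed disc of
  -- radius `r`.
  let b : ContDiffBump (0 : ℂ) := ⟨(1 + r) / 2, (3 + r) / 4, by linarith [hr.1], by linarith [hr.2]⟩
  set V : ℂ → ℂ := fun x => b x • U x with hV
  have hVU : ∀ x ∈ closedBall (0 : ℂ) r, V =ᶠ[𝓝 x] U := by
    intro x hx
    have hxb : x ∈ ball (0 : ℂ) b.rIn := by
      rw [mem_closedBall_zero_iff] at hx
      rw [mem_ball_zero_iff]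
      change ‖x‖ < (1 + r) / 2
      linarith [hr.2]
    filter_upwards [isOpen_ball.mem_nhds hxb] with y hy
    simp only [hV, b.one_of_mem_closedBall (ball_subset_closedBall hy), one_smul]
  have hVs : ContDiff ℝ 2 V := by
    rw [contDiff_iff_contDiffAt]
    intro x
    by_cases hx : x ∈ ball (0 : ℂ) 1
    · exact b.contDiffAt.smul ((hU x hx).of_le (by exact WithTop.coe_le_coe.2 le_top))
    · have hx' : x ∈ (closedBall (0 : ℂ) b.rOut)ᶜ := by
        rw [mem_ball_zero_iff, not_lt] at hx
        rw [Set.mem_compl_iff, mem_closedBall_zero_iff, not_le]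
        change (3 + r) / 4 < ‖x‖
        linarith [hr.2]
      refine (contDiffAt_const (c := (0 : ℂ))).congr_of_eventuallyEq ?_
      filter_upwards [isClosed_closedBall.isOpen_compl.mem_nhds hx'] with y hy
      rw [Set.mem_compl_iff, mem_closedBall, not_le] at hy
      simp only [hV, b.zero_of_le_dist hy.le, zero_smul]
  have hVv : ∀ x ∈ closedBall (0 : ℂ) r, V x = U x := fun x hx => (hVU x hx).self_of_nhds
  have hmem : ∀ s : ℝ, 0 ≤ s → s ≤ r → ∀ θ : ℝ,
      (s : ℂ) * Complex.exp (θ * Complex.I) ∈ closedBall (0 : ℂ) r := by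
    intro s hs hsr θ
    rw [mem_closedBall_zero_iff, norm_mul, Complex.norm_exp_ofReal_mul_I, Complex.norm_real,
      Real.norm_of_nonneg hs, mul_one]
    exact hsr
  have hrad : circIntRadial V (1 / 4) = circIntRadial U (1 / 4) := by
    refine intervalIntegral.integral_congr fun θ _ => ?_
    simp only [(hVU _ (hmem (1 / 4) (by norm_num) hr.1.le θ)).fderiv_eq]
  have hann := integral_annulus_green_mul_lap hVs (a := 1 / 4) (by norm_num) hr.1.le
  have hsplit : ∫ x in ball (0 : ℂ) 1, (green r x : ℂ) * lap U x
      = (∫ x in closedBall (0 : ℂ) (1 / 4), (green r x : ℂ) * lap U x)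
        + ∫ x in {x : ℂ | ‖x‖ ∈ Set.Ioc (1 / 4) r}, (green r x : ℂ) * lap V x := by
    have hm : MeasurableSet {x : ℂ | ‖x‖ ∈ Set.Ioc (1 / 4) r} := measurable_norm measurableSet_Ioc
    have hsub : closedBall (0 : ℂ) (1 / 4) ∪ {x : ℂ | ‖x‖ ∈ Set.Ioc (1 / 4) r} ⊆ ball 0 1 := by
      rintro x (hx | hx)
      · exact closedBall_subset_ball (by norm_num) hx
      · exact mem_ball_zero_iff.2 (lt_of_le_of_lt hx.2 hr.2)
    have hint := integrableOn_green_mul hlap hr0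
    rw [setIntegral_congr_fun hm (g := fun x => (green r x : ℂ) * lap U x), ← setIntegral_union,
      setIntegral_eq_of_subset_of_forall_sdiff_eq_zero measurableSet_ball hsub]
    · intro x hx
      have hxr : r ≤ ‖x‖ := by
        by_contra hlt
        refine hx.2 ?_
        rcases le_or_gt ‖x‖ (1 / 4) with h | h
        · exact Or.inl (mem_closedBall_zero_iff.2 h)
        · exact Or.inr ⟨h, (not_le.1 hlt).le⟩
      rw [green_eq_zero hr0.1.le hxr, Complex.ofReal_zero, zero_mul]
    · rw [Set.disjoint_left]
      intro x hx hx2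
      exact absurd (mem_closedBall_zero_iff.1 hx) (not_le.2 hx2.1)
    · exact hm
    · exact hint.mono_set (Set.subset_union_left.trans hsub)
    · exact hint.mono_set (Set.subset_union_right.trans hsub)
    · intro x hx
      have := hVU x (mem_closedBall_zero_iff.2 hx.2)
      simp only [lap, this.fderiv.fderiv_eq]
  rw [hsplit, hann, hrad]
  have hb : ∀ s : ℝ, 0 ≤ s → s ≤ r → ‖circInt V s‖ ≤ C * (2 * Real.pi) := fun s hs hsr =>
    norm_circInt_le hs fun x hx => by
      rw [hVv x (mem_closedBall_zero_iff.2 (hx.trans_le hsr))]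
      exact hC x
  have hlog0 : 0 ≤ Real.log (r / (1 / 4)) := Real.log_nonneg (by
    rw [le_div_iff₀ (by norm_num)]; linarith [hr.1])
  have hlog : Real.log (r / (1 / 4)) ≤ 3 := by
    refine (Real.log_le_sub_one_of_pos (by linarith [hr.1])).trans ?_
    linarith [hr.2]
  have hpi : ‖(2 * Real.pi : ℂ)⁻¹‖ ≤ 1 := by
    rw [norm_inv, norm_mul, Complex.norm_ofNat, Complex.norm_real,
      Real.norm_of_nonneg Real.pi_pos.le]
    exact inv_le_one_of_one_le₀ (by linarith [Real.pi_gt_three])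
  refine (norm_add_le _ _).trans (add_le_add (hC₁ r hr0) ?_)
  rw [norm_mul]
  refine (mul_le_of_le_one_left (norm_nonneg _) hpi).trans ?_
  refine (norm_sub_le _ _).trans (add_le_add ((norm_sub_le _ _).trans ?_) ?_)
  · have h1 := hb r hr0.1.le le_rfl
    have h2 := hb (1 / 4) (by norm_num) hr.1.le
    linarith
  · rw [norm_mul, norm_mul, Complex.norm_real, Complex.norm_real, Real.norm_of_nonneg hlog0,
      Real.norm_of_nonneg (by norm_num)]
    have : (1 / 4 : ℝ) * P ≤ P := by linarith [norm_nonneg (circIntRadial U (1 / 4))]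
    exact mul_le_mul hlog this (by positivity) (by norm_num)

end Jensen

/-! ### Leaves, plaques, and tangency of a disc to a lamination -/

section Leaves

variable {E : Type u} [NormedAddCommGroup E] [NormedSpace ℂ E]
variable {M : Type u'} [TopologicalSpace M] [ChartedSpace E M]

/-- A countable preconnected subset of a normal Hausdorff space has at most one point. -/
theorem subsingleton_of_countable_of_isPreconnected {Z : Type*} [TopologicalSpace Z] [T4Space Z]
    {s : Set Z} (hc : s.Countable) (hs : IsPreconnected s) : s.Subsingleton := by
  intro x hx y hy
  by_contra hxy
  obtain ⟨f, hf0, hf1, -⟩ := exists_continuous_zero_one_of_isClosed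
    (isClosed_singleton (x := x)) (isClosed_singleton (x := y)) (by simpa using hxy)
  have h0 : f x = 0 := hf0 rfl
  have h1 : f y = 1 := hf1 rfl
  have h2 : Set.Icc (0 : ℝ) 1 ⊆ f '' s := by
    have := hs.intermediate_value hx hy f.continuous.continuousOn
    rwa [h0, h1] at this
  have h3 : volume (Set.Icc (0 : ℝ) 1) = 0 := ((hc.image f).mono h2).measure_zero volume
  simp at h3

namespace FlowBox

variable {Y : Set M} (B : FlowBox.{u, u', v} E Y)

theorem injective {z z' : ℂ} (hz : z ∈ ball (0 : ℂ) 1) (hz' : z' ∈ ball (0 : ℂ) 1) {t t' : B.T}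
    (h : B.param z t = B.param z' t') : z = z' ∧ t = t' := by
  let := B.topT
  have := B.isEmbedding.injective (a₁ := (⟨z, hz⟩, t)) (a₂ := (⟨z', hz'⟩, t')) h
  simpa using this

theorem mem_box {p : M} : p ∈ B.box ↔ ∃ z ∈ ball (0 : ℂ) 1, ∃ t, B.param z t = p := by
  simp only [box, plaque, Set.mem_iUnion, Set.mem_image]
  exact ⟨fun ⟨t, z, hz, h⟩ => ⟨z, hz, t, h⟩, fun ⟨z, hz, t, h⟩ => ⟨t, z, hz, h⟩⟩

theorem exists_isOpen_box : ∃ V : Set M, IsOpen V ∧ B.box = V ∩ Y := by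
  obtain ⟨V, hV, h⟩ := B.isOpen_box
  exact ⟨V, hV, by rw [← h]; ext p; exact B.mem_box⟩

theorem plaque_subset_box (t : B.T) : B.plaque t ⊆ B.box := Set.subset_iUnion _ t

theorem box_subset : B.box ⊆ Y := by
  obtain ⟨V, -, h⟩ := B.exists_isOpen_box
  rw [h]
  exact Set.inter_subset_right

theorem continuousOn_param (t : B.T) : ContinuousOn (fun z => B.param z t) (ball 0 1) :=
  fun z hz => (B.holomorphic t z hz).continuousWithinAt

theorem isConnected_plaque (t : B.T) : IsConnected (B.plaque t) :=
  ((convex_ball (0 : ℂ) 1).isConnected (nonempty_ball.2 one_pos)).image _ (B.continuousOn_param t)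

/-- A plaque of one flow box meets at most one plaque of another compatible one. -/
theorem Compatible.plaque_unique {B B' : FlowBox.{u, u', v} E Y} (h : B.Compatible B') (t : B.T) :
    {t' | (B.plaque t ∩ B'.plaque t').Nonempty}.Subsingleton := by
  have key : ∀ t', (B.plaque t ∩ B'.plaque t').Nonempty → (B.plaque t ∩ B'.box).Nonempty :=
    fun t' ht => ht.mono (Set.inter_subset_inter_right _ (B'.plaque_subset_box t'))
  intro t₁ h₁ t₂ h₂
  -- Compatibility supplies a single `t'` for the whole intersection with the box; injectivity of
  -- the second flow box then forces every plaque met to be the one over `t'`.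
  obtain ⟨t', η, -, hη⟩ := h t (key t₁ h₁)
  have aux : ∀ t₃, (B.plaque t ∩ B'.plaque t₃).Nonempty → t₃ = t' := by
    rintro t₃ ⟨p, ⟨z, hz, rfl⟩, w, hw, hwz⟩
    have hb : B.param z t ∈ B'.box := B'.mem_box.2 ⟨w, hw, t₃, hwz⟩
    obtain ⟨h1, h2⟩ := hη z hz hb
    exact (B'.injective hw h1 (hwz.trans h2.symm)).2
  rw [aux t₁ h₁, aux t₂ h₂]

end FlowBox

namespace Lamination

variable (Λ : Lamination.{u, u', v, w} E M)

/-- The plaque with the given label. -/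
def labelledPlaque (a : Σ i, (Λ.flowBox i).T) : Set M := (Λ.flowBox a.1).plaque a.2

/-- The labels of the plaques of the flow boxes in `J` that meet the plaque with label `a`. -/
def meeting (J : Set Λ.ι) (a : Σ i, (Λ.flowBox i).T) : Set (Σ i, (Λ.flowBox i).T) :=
  {b | b.1 ∈ J ∧ (Λ.labelledPlaque a ∩ Λ.labelledPlaque b).Nonempty}

/-- The labels of the plaques that are joined to the plaque with label `a` by a chain of `n`
plaques of the flow boxes in `J`. -/
def chain (J : Set Λ.ι) (a : Σ i, (Λ.flowBox i).T) : ℕ → Set (Σ i, (Λ.flowBox i).T)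
  | 0 => {a}
  | n + 1 => ⋃ b ∈ chain J a n, Λ.meeting J b

/-- The union of all plaques joined to the plaque with label `a`. -/
def chainUnion (J : Set Λ.ι) (a : Σ i, (Λ.flowBox i).T) : Set M :=
  ⋃ b ∈ ⋃ n, Λ.chain J a n, Λ.labelledPlaque b

variable {Λ}

theorem countable_meeting {J : Set Λ.ι} (hJ : J.Countable) (a : Σ i, (Λ.flowBox i).T) :
    (Λ.meeting J a).Countable := by
  refine (hJ.biUnion (t := fun j _ => (fun t => (⟨j, t⟩ : Σ i, (Λ.flowBox i).T)) ''
    {t | ((Λ.flowBox a.1).plaque a.2 ∩ (Λ.flowBox j).plaque t).Nonempty})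
    fun j _ => ?_).mono ?_
  · exact (((Λ.compatible a.1 j).plaque_unique a.2).countable).image _
  · rintro ⟨j, t⟩ ⟨hj, h⟩
    exact Set.mem_biUnion hj ⟨t, h, rfl⟩

theorem countable_chain {J : Set Λ.ι} (hJ : J.Countable) (a : Σ i, (Λ.flowBox i).T) :
    (⋃ n, Λ.chain J a n).Countable := by
  refine Set.countable_iUnion fun n => ?_
  induction n with
  | zero => exact Set.countable_singleton a
  | succ n ih => exact ih.biUnion fun b _ => countable_meeting hJ b

theorem mem_chain_of_meeting {J : Set Λ.ι} {a b c : Σ i, (Λ.flowBox i).T}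
    (hb : b ∈ ⋃ n, Λ.chain J a n) (hc : c ∈ Λ.meeting J b) : c ∈ ⋃ n, Λ.chain J a n := by
  obtain ⟨n, hn⟩ := Set.mem_iUnion.1 hb
  exact Set.mem_iUnion.2 ⟨n + 1, Set.mem_biUnion hn hc⟩

/-- Each plaque added to a chain meets the preceding one, so every point is joined to a base point
of the initial plaque by a preconnected union. -/
theorem isConnected_chainUnion (J : Set Λ.ι) (a : Σ i, (Λ.flowBox i).T) :
    IsConnected (Λ.chainUnion J a) := by
  have hsub : ∀ n, ∀ b ∈ Λ.chain J a n, Λ.labelledPlaque b ⊆ Λ.chainUnion J a := fun n b hb =>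
    Set.subset_biUnion_of_mem (u := fun b => Λ.labelledPlaque b) (Set.mem_iUnion.2 ⟨n, hb⟩)
  obtain ⟨x, hx⟩ := ((Λ.flowBox a.1).isConnected_plaque a.2).nonempty
  have hxa : x ∈ Λ.chainUnion J a := hsub 0 a rfl hx
  refine ⟨⟨x, hxa⟩, ?_⟩
  have key : ∀ n, ∀ b ∈ Λ.chain J a n, ∃ t ⊆ Λ.chainUnion J a,
      x ∈ t ∧ Λ.labelledPlaque b ⊆ t ∧ IsPreconnected t := by
    intro n
    induction n with
    | zero =>
      rintro b rfl
      exact ⟨_, hsub 0 b rfl, hx, subset_rfl,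
        ((Λ.flowBox b.1).isConnected_plaque b.2).isPreconnected⟩
    | succ n ih =>
      intro c hc
      obtain ⟨b, hb, hbc⟩ := Set.mem_iUnion₂.1 hc
      obtain ⟨t, ht, hxt, hbt, htc⟩ := ih b hb
      refine ⟨t ∪ Λ.labelledPlaque c, Set.union_subset ht (hsub (n + 1) c hc), Or.inl hxt,
        Set.subset_union_right, ?_⟩
      obtain ⟨y, hyb, hyc⟩ := hbc.2
      exact htc.union y (hbt hyb) hyc ((Λ.flowBox c.1).isConnected_plaque c.2).isPreconnected
  refine isPreconnected_of_forall x fun y hy => ?_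
  obtain ⟨b, hb, hyb⟩ := Set.mem_iUnion₂.1 hy
  obtain ⟨n, hn⟩ := Set.mem_iUnion.1 hb
  obtain ⟨t, h1, h2, h3, h4⟩ := key n b hn
  exact ⟨t, h1, h2, h3 hyb, h4⟩

/-- A union of chains of plaques is saturated. -/
theorem plaque_subset_chainUnion {J : Set Λ.ι} (hJ : ⋃ i ∈ J, (Λ.flowBox i).box = Λ.X \ Λ.S)
    (a : Σ i, (Λ.flowBox i).T) (i : Λ.ι) (t : (Λ.flowBox i).T)
    (h : ((Λ.flowBox i).plaque t ∩ Λ.chainUnion J a).Nonempty) :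
    (Λ.flowBox i).plaque t ⊆ Λ.chainUnion J a := by
  set Q := (Λ.flowBox i).plaque t with hQ
  set C := ⋃ n, Λ.chain J a n with hC
  have hQY : Q ⊆ Λ.X \ Λ.S :=
    ((Λ.flowBox i).plaque_subset_box t).trans (Λ.flowBox i).box_subset
  choose V hVo hV using fun j => (Λ.flowBox j).exists_isOpen_box
  -- `Q` meets at most one plaque of each box; `J₁` singles out the boxes where that plaque belongs
  -- to the chain. The boxes of `J` inside and outside `J₁` give two open sets covering `Q`, one
  -- contained in the chain union along `Q`, the other disjoint from it. Connectedness of `Q` leaves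
  -- only one.
  set J₁ := {j | ∃ t', (⟨j, t'⟩ : Σ i, (Λ.flowBox i).T) ∈ C ∧
    (Q ∩ (Λ.flowBox j).plaque t').Nonempty} with hJ₁
  have hbox : ∀ j, ∀ p ∈ Q, p ∈ V j → ∃ t', p ∈ (Λ.flowBox j).plaque t' := by
    intro j p hp hpV
    have : p ∈ (Λ.flowBox j).box := by
      rw [hV]
      exact ⟨hpV, hQY hp⟩
    exact Set.mem_iUnion.1 this
  have hin : ∀ p ∈ Q, p ∈ ⋃ j ∈ J ∩ J₁, V j → p ∈ Λ.chainUnion J a := by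
    intro p hp hpO
    obtain ⟨j, ⟨-, t', ht', hne⟩, hpV⟩ := Set.mem_iUnion₂.1 hpO
    obtain ⟨t'', hp''⟩ := hbox j p hp hpV
    have : t'' = t' := (Λ.compatible i j).plaque_unique t ⟨p, hp, hp''⟩ hne
    subst this
    exact Set.mem_biUnion ht' hp''
  have hout : ∀ p ∈ Q, p ∈ ⋃ j ∈ J \ J₁, V j → p ∉ Λ.chainUnion J a := by
    intro p hp hpO hpA
    obtain ⟨j, ⟨hj, hj₁⟩, hpV⟩ := Set.mem_iUnion₂.1 hpO
    obtain ⟨t'', hp''⟩ := hbox j p hp hpV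
    obtain ⟨b, hb, hpb⟩ := Set.mem_iUnion₂.1 hpA
    exact hj₁ ⟨t'', mem_chain_of_meeting hb ⟨hj, p, hpb, hp''⟩, p, hp, hp''⟩
  have hcov : Q ⊆ (⋃ j ∈ J ∩ J₁, V j) ∪ ⋃ j ∈ J \ J₁, V j := by
    intro p hp
    have hpJ := hQY hp
    rw [← hJ] at hpJ
    obtain ⟨j, hj, hpj⟩ := Set.mem_iUnion₂.1 hpJ
    rw [hV] at hpj
    by_cases h1 : j ∈ J₁
    · exact Or.inl (Set.mem_biUnion (show j ∈ J ∩ J₁ from ⟨hj, h1⟩) hpj.1)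
    · exact Or.inr (Set.mem_biUnion (show j ∈ J \ J₁ from ⟨hj, h1⟩) hpj.1)
  have hconn := ((Λ.flowBox i).isConnected_plaque t).isPreconnected
    (⋃ j ∈ J ∩ J₁, V j) (⋃ j ∈ J \ J₁, V j) (isOpen_biUnion fun j _ => hVo j)
    (isOpen_biUnion fun j _ => hVo j) hcov
  obtain ⟨q, hqQ, hqA⟩ := h
  have hq1 : q ∈ ⋃ j ∈ J ∩ J₁, V j :=
    (hcov hqQ).resolve_right fun h => hout q hqQ h hqA
  intro p hp
  rcases hcov hp with h1 | h2
  · exact hin p hp h1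
  · obtain ⟨y, hyQ, hy1, hy2⟩ := hconn ⟨q, hqQ, hq1⟩ ⟨p, hp, h2⟩
    exact absurd (hin y hyQ hy1) (hout y hyQ hy2)

theorem exists_countable_cover [SecondCountableTopology M] (Λ : Lamination.{u, u', v, w} E M) :
    ∃ J : Set Λ.ι, J.Countable ∧ ⋃ i ∈ J, (Λ.flowBox i).box = Λ.X \ Λ.S := by
  choose V hVo hV using fun j => (Λ.flowBox j).exists_isOpen_box
  obtain ⟨J, hJ, hJV⟩ := TopologicalSpace.isOpen_iUnion_countable V hVo
  have h : ⋃ i ∈ J, (Λ.flowBox i).box = ⋃ i, (Λ.flowBox i).box := by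
    simp only [hV, ← Set.iUnion_inter]
    rw [hJV]
  exact ⟨J, hJ, h.trans Λ.cover⟩

/-- A leaf meets only countably many plaques of each flow box. -/
theorem IsLeaf.countable_plaques [SecondCountableTopology M] {L : Set M} (hL : Λ.IsLeaf L)
    (i : Λ.ι) : {t | ((Λ.flowBox i).plaque t ∩ L).Nonempty}.Countable := by
  obtain ⟨J, hJc, hJ⟩ := Λ.exists_countable_cover
  obtain ⟨⟨hLY, hLc, hLs⟩, hmin⟩ := hL
  obtain ⟨p, hp⟩ := hLc.nonempty
  have hpY := hLY hp
  rw [← hJ] at hpY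
  obtain ⟨j, -, hpj⟩ := Set.mem_iUnion₂.1 hpY
  obtain ⟨t₀, hpt⟩ := Set.mem_iUnion.1 hpj
  set a : Σ i, (Λ.flowBox i).T := ⟨j, t₀⟩ with ha
  have hchain : ∀ n, ∀ b ∈ Λ.chain J a n, Λ.labelledPlaque b ⊆ L := by
    intro n
    induction n with
    | zero =>
      rintro b rfl
      exact hLs j t₀ ⟨p, hpt, hp⟩
    | succ n ih =>
      intro c hc
      obtain ⟨b, hb, hbc⟩ := Set.mem_iUnion₂.1 hc
      obtain ⟨y, hyb, hyc⟩ := hbc.2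
      exact hLs c.1 c.2 ⟨y, hyc, ih b hb hyb⟩
  have hsub : Λ.chainUnion J a ⊆ L := by
    refine Set.iUnion₂_subset fun b hb => ?_
    obtain ⟨n, hn⟩ := Set.mem_iUnion.1 hb
    exact hchain n b hn
  -- The chain union is connected, saturated and contained in the leaf, so minimality makes it the
  -- whole leaf.
  have hLA : L ⊆ Λ.chainUnion J a := hmin ⟨hsub.trans hLY, isConnected_chainUnion J a,
    fun i t => plaque_subset_chainUnion hJ a i t⟩ hsub
  refine ((countable_chain hJc a).biUnion (t := fun b _ =>
    {t | ((Λ.flowBox b.1).plaque b.2 ∩ (Λ.flowBox i).plaque t).Nonempty}) fun b _ =>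
      ((Λ.compatible b.1 i).plaque_unique b.2).countable).mono ?_
  rintro t ⟨q, hqt, hqL⟩
  obtain ⟨b, hb, hqb⟩ := Set.mem_iUnion₂.1 (hLA hqL)
  exact Set.mem_biUnion hb ⟨q, hqb, hqt⟩

/-- A continuous map into a leaf is locally a map into a single plaque. -/
theorem IsLeaf.exists_plaque [SecondCountableTopology M] [T4Space M] {L : Set M}
    (hL : Λ.IsLeaf L) {φ : ℂ → M} {s : Set ℂ} (hs : IsOpen s) (hφ : ContinuousOn φ s)
    (hφL : φ '' s ⊆ L) {x₀ : ℂ} (hx₀ : x₀ ∈ s) :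
    ∃ (i : Λ.ι) (t : (Λ.flowBox i).T) (ζ : ℂ → ℂ) (N : Set ℂ), IsOpen N ∧ x₀ ∈ N ∧ N ⊆ s ∧
      ContinuousOn ζ N ∧ ∀ x ∈ N, ζ x ∈ ball (0 : ℂ) 1 ∧ (Λ.flowBox i).param (ζ x) t = φ x := by
  have hY : ∀ x ∈ s, φ x ∈ Λ.X \ Λ.S := fun x hx => hL.1.1 (hφL ⟨x, hx, rfl⟩)
  have h0 := hY x₀ hx₀
  rw [← Λ.cover] at h0
  obtain ⟨i, hi⟩ := Set.mem_iUnion.1 h0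
  set B := Λ.flowBox i with hB
  let := B.topT
  obtain ⟨V, hVo, hV⟩ := B.exists_isOpen_box
  have hx₀V : x₀ ∈ s ∩ φ ⁻¹' V := ⟨hx₀, (hV.subset hi).1⟩
  obtain ⟨ε, hε, hball⟩ := Metric.isOpen_iff.1 (hφ.isOpen_inter_preimage hs hVo) x₀ hx₀V
  have hpre : ∀ x : ball x₀ ε, ∃ q : ball (0 : ℂ) 1 × B.T, B.param q.1 q.2 = φ x := by
    intro x
    have h1 : φ x ∈ B.box := by
      rw [hV]
      exact ⟨(hball x.2).2, hY x (hball x.2).1⟩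
    obtain ⟨z, hz, t, h⟩ := B.mem_box.1 h1
    exact ⟨(⟨z, hz⟩, t), h⟩
  choose τ hτ using hpre
  have hφε : Continuous fun x : ball x₀ ε => φ x :=
    continuousOn_iff_continuous_domRestrict.1 (hφ.mono fun x hx => (hball hx).1)
  have hτc : Continuous τ := by
    rw [B.isEmbedding.isInducing.continuous_iff]
    exact hφε.congr fun x => (hτ x).symm
  have h0b : (0 : ℂ) ∈ ball (0 : ℂ) 1 := mem_ball_self one_pos
  have hparam : Continuous fun t : B.T => B.param 0 t :=
    B.isEmbedding.continuous.comp (Continuous.prodMk_right (⟨0, h0b⟩ : ball (0 : ℂ) 1))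
  -- The transversal `B.T` has no separation property of its own, so transversal positions are
  -- replaced by the centres of their plaques in `M`. Their set is countable, as the leaf meets
  -- countably many plaques, and connected, as the image of a ball.
  have hrange : (Set.range fun x : ball x₀ ε => B.param 0 (τ x).2).Subsingleton := by
    refine subsingleton_of_countable_of_isPreconnected ?_ ?_
    · refine ((hL.countable_plaques i).image fun t => B.param 0 t).mono ?_
      rintro _ ⟨x, rfl⟩
      exact ⟨(τ x).2, ⟨φ x, ⟨(τ x).1, (τ x).1.2, hτ x⟩, hφL ⟨x, (hball x.2).1, rfl⟩⟩, rfl⟩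
    · have : PreconnectedSpace (ball x₀ ε) :=
        Subtype.preconnectedSpace (convex_ball x₀ ε).isPreconnected
      exact isPreconnected_range (hparam.comp (continuous_snd.comp hτc))
  set y₀ : ball x₀ ε := ⟨x₀, mem_ball_self hε⟩ with hy₀
  have hconst : ∀ x, (τ x).2 = (τ y₀).2 := fun x =>
    (B.injective h0b h0b (hrange ⟨x, rfl⟩ ⟨y₀, rfl⟩)).2
  classical
  refine ⟨i, (τ y₀).2, fun x => if h : x ∈ ball x₀ ε then (τ ⟨x, h⟩).1 else 0, ball x₀ ε,
    isOpen_ball, mem_ball_self hε, fun x hx => (hball hx).1, ?_, fun x hx => ?_⟩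
  · rw [continuousOn_iff_continuous_domRestrict]
    refine (continuous_subtype_val.comp (continuous_fst.comp hτc)).congr fun x => ?_
    have hx := x.2
    simp only [Set.domRestrict_apply, dif_pos hx, Function.comp_apply]
  · simp only [dif_pos hx]
    refine ⟨(τ ⟨x, hx⟩).1.2, ?_⟩
    rw [← hconst ⟨x, hx⟩]
    exact hτ ⟨x, hx⟩

end Lamination

/-- A curve which is continuously reparametrized into an immersed curve is tangent to it. -/
theorem apply_deriv_eq_zero_of_comp {ψ f : ℂ → E} {ζ : ℂ → ℂ} {x₀ : ℂ} {a b : E}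
    (hψ : HasDerivAt ψ a (ζ x₀)) (ha : a ≠ 0) (hζ : ContinuousAt ζ x₀)
    (hf : HasDerivAt f b x₀) (hfψ : ∀ᶠ x in 𝓝 x₀, ψ (ζ x) = f x) (ℓ : E →L[ℂ] ℂ) (hℓ : ℓ a = 0) :
    ℓ b = 0 := by
  -- Since `ψ'` does not vanish at `ζ x₀`, increments of `ψ` control those of its variable. Hence
  -- `ζ`, only known to be continuous, satisfies `ζ x - ζ x₀ = O(x - x₀)`, and `ℓ ∘ ψ = ℓ(ψ(ζ x₀)) +
  -- o` transfers to `ℓ ∘ f`.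
  have h1 : (fun x => ζ x - ζ x₀) =O[𝓝 x₀] fun x => ψ (ζ x) - ψ (ζ x₀) :=
    (hψ.isTheta_sub ha).isBigO_symm.comp_tendsto
      (Filter.Tendsto.prodMk hζ tendsto_const_pure)
  have h2 : (fun x => ψ (ζ x) - ψ (ζ x₀)) =ᶠ[𝓝 x₀] fun x => f x - f x₀ := by
    filter_upwards [hfψ] with x hx
    rw [hx, hfψ.self_of_nhds]
  have h3 : (fun x => ζ x - ζ x₀) =O[𝓝 x₀] fun x => x - x₀ :=
    (h1.trans_eventuallyEq h2).trans hf.isBigO_sub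
  have h4 : HasDerivAt (fun z => ℓ (ψ z)) 0 (ζ x₀) := by
    have := ℓ.hasFDerivAt.comp_hasDerivAt (ζ x₀) hψ
    rwa [hℓ] at this
  have h5 : (fun z => ℓ (ψ z) - ℓ (ψ (ζ x₀))) =o[𝓝 (ζ x₀)] fun z => z - ζ x₀ := by
    simpa using hasDerivAt_iff_isLittleO.1 h4
  have h6 : (fun x => ℓ (f x) - ℓ (f x₀)) =o[𝓝 x₀] fun x => x - x₀ := by
    refine Asymptotics.IsLittleO.congr' ((h5.comp_tendsto hζ).trans_isBigO h3) ?_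
      EventuallyEq.rfl
    filter_upwards [hfψ] with x hx
    simp only [Function.comp_apply, hx, hfψ.self_of_nhds]
  have h7 : HasDerivAt (fun x => ℓ (f x)) 0 x₀ := by
    rw [hasDerivAt_iff_isLittleO]
    simpa using h6
  exact (ℓ.hasFDerivAt.comp_hasDerivAt x₀ hf).unique h7

/-- Forms defining a lamination vanish on the velocity of a disc contained in a leaf. -/
theorem Lamination.DefinedBy.apply_discDeriv_eq_zero [CompleteSpace E] [IsManifold 𝓘(ℂ, E) ω M]
    [SecondCountableTopology M] [T4Space M] {Λ : Lamination.{u, u', v, w} E M} {L : Set M}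
    (hL : Λ.IsLeaf L) {φ : ℂ → M} {s : Set ℂ} (hs : IsOpen s)
    (hφ : MDifferentiableOn 𝓘(ℂ, ℂ) 𝓘(ℂ, E) φ s) (hφL : φ '' s ⊆ L) {U : Set M} (hU : IsOpen U)
    {J : Type*} {γ : J → M → E →L[ℂ] ℂ} (hγ : Λ.DefinedBy U γ) (j : J) {x₀ : ℂ} (hx₀ : x₀ ∈ s)
    (hx₀U : φ x₀ ∈ U) : γ j (φ x₀) (discDeriv φ x₀) = 0 := by
  obtain ⟨hγc, -, hγt⟩ := hγ j
  have hφc : ContinuousOn φ s := fun x hx => (hφ x hx).continuousWithinAt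
  obtain ⟨i, t, ζ, N, hNo, hx₀N, hNs, hζ, hζN⟩ := hL.exists_plaque hs hφc hφL hx₀
  set κ := chartAt E (φ x₀) with hκ
  have hκ₀ : φ x₀ ∈ κ.source := mem_chart_source E (φ x₀)
  set ψ : ℂ → M := fun z => (Λ.flowBox i).param z t with hψ
  have hφd : ∀ x ∈ s, MDifferentiableAt 𝓘(ℂ, ℂ) 𝓘(ℂ, E) φ x := fun x hx =>
    hφ.mdifferentiableAt (hs.mem_nhds hx)
  have hψd : ∀ z ∈ ball (0 : ℂ) 1, MDifferentiableAt 𝓘(ℂ, ℂ) 𝓘(ℂ, E) ψ z := fun z hz =>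
    ((Λ.flowBox i).holomorphic t).mdifferentiableAt (isOpen_ball.mem_nhds hz)
  have hz₀ : ζ x₀ ∈ ball (0 : ℂ) 1 := (hζN x₀ hx₀N).1
  have hψ₀ : ψ (ζ x₀) = φ x₀ := (hζN x₀ hx₀N).2
  have hζc : ContinuousAt ζ x₀ := hζ.continuousAt (hNo.mem_nhds hx₀N)
  have hψsrc : ∀ᶠ z in 𝓝 (ζ x₀), z ∈ ball (0 : ℂ) 1 ∧ ψ z ∈ κ.source :=
    (isOpen_ball.eventually_mem hz₀).and ((hψd _ hz₀).continuousAt.eventually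
      (κ.open_source.mem_nhds (by rwa [hψ₀])))
  have hψdiff : ∀ᶠ z in 𝓝 (ζ x₀), DifferentiableAt ℂ (κ ∘ ψ) z := by
    filter_upwards [hψsrc] with z hz
    exact differentiableAt_chart_comp (hψd z hz.1) hz.2
  have hψan : AnalyticAt ℂ (κ ∘ ψ) (ζ x₀) :=
    Complex.analyticAt_iff_eventually_differentiableAt.2 hψdiff
  have hφev : ∀ᶠ x in 𝓝 x₀, x ∈ N ∧ φ x ∈ κ.source ∧ φ x ∈ U :=
    (hNo.eventually_mem hx₀N).and (((hφd x₀ hx₀).continuousAt.eventually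
      (κ.open_source.mem_nhds hκ₀)).and ((hφd x₀ hx₀).continuousAt.eventually (hU.mem_nhds hx₀U)))
  have hφdiff : ∀ᶠ x in 𝓝 x₀, DifferentiableAt ℂ (κ ∘ φ) x := by
    filter_upwards [hφev] with x hx
    exact differentiableAt_chart_comp (hφd x (hNs hx.1)) hx.2.1
  have hφan : AnalyticAt ℂ (κ ∘ φ) x₀ :=
    Complex.analyticAt_iff_eventually_differentiableAt.2 hφdiff
  set H : ℂ → ℂ := fun x => ((γ j (φ x)).comp (coordJac (φ x₀) (φ x))) (deriv (κ ∘ φ) x) with hH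
  have hHc : ContinuousAt H x₀ := by
    have h1 : ContinuousWithinAt (fun p => (γ j p).comp (coordJac (φ x₀) p))
        (Λ.X ∩ U ∩ κ.source) (φ x₀) :=
      hγc (φ x₀) (φ x₀) ⟨⟨(hL.1.1 (hφL ⟨x₀, hx₀, rfl⟩)).1, hx₀U⟩, hκ₀⟩
    have h2 : Tendsto φ (𝓝 x₀) (𝓝[Λ.X ∩ U ∩ κ.source] (φ x₀)) := by
      refine tendsto_nhdsWithin_iff.2 ⟨(hφd x₀ hx₀).continuousAt, ?_⟩
      filter_upwards [hφev] with x hx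
      exact ⟨⟨(hL.1.1 (hφL ⟨x, hNs hx.1, rfl⟩)).1, hx.2.2⟩, hx.2.1⟩
    have h3 : ContinuousAt (fun x => (γ j (φ x)).comp (coordJac (φ x₀) (φ x))) x₀ := h1.tendsto.comp h2
    exact h3.clm_apply hφan.deriv.continuousAt
  have hHγ : H x₀ = γ j (φ x₀) (discDeriv φ x₀) := by
    rw [discDeriv_eq_coordJac (hφd x₀ hx₀) hκ₀]
    rfl
  rw [← hHγ]
  have himm : ∀ᶠ x in 𝓝 x₀, deriv (κ ∘ ψ) (ζ x) ≠ 0 → H x = 0 := by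
    filter_upwards [hφev, hφev.eventually_nhds, hζc.eventually hψsrc] with x hx hx' hzx hne
    have hψx : ψ (ζ x) = φ x := (hζN x hx.1).2
    refine apply_deriv_eq_zero_of_comp (ψ := κ ∘ ψ) (ζ := ζ)
      (differentiableAt_chart_comp (hψd _ hzx.1) hzx.2).hasDerivAt hne
      (hζ.continuousAt (hNo.mem_nhds hx.1))
      (differentiableAt_chart_comp (hφd x (hNs hx.1)) hx.2.1).hasDerivAt ?_ _ ?_
    · filter_upwards [hx'] with y hy
      simp only [Function.comp_apply, hψ]
      rw [(hζN y hy.1).2]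
    · have h1 := hγt i t (ζ x) hzx.1 (by
        change ψ (ζ x) ∈ U
        rw [hψx]; exact hx.2.2)
      change γ j (ψ (ζ x)) (discDeriv ψ (ζ x)) = 0 at h1
      rw [discDeriv_eq_coordJac (hψd _ hzx.1) hzx.2, hψx] at h1
      exact h1
  -- A plaque parametrization is injective but may fail to be an immersion, as for `z ↦ (z², z³)`.
  -- Its derivative cannot vanish identically, by injectivity, so its zeros are isolated. Either `ζ`
  -- takes immersed values arbitrarily near `x₀`, and `H x₀ = 0` by continuity, or `ζ` is locally
  -- constant and then so is `φ`.
  rcases hψan.deriv.eventually_eq_zero_or_eventually_ne_zero with h0 | hne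
  · exfalso
    obtain ⟨ε, hε, hball⟩ := Metric.eventually_nhds_iff_ball.1 ((h0.and hψdiff).and hψsrc)
    obtain ⟨w, hw, hwne⟩ : ∃ w ∈ ball (ζ x₀) ε, w ≠ ζ x₀ :=
      ⟨ζ x₀ + (ε / 2 : ℝ), by simp [abs_of_pos hε, hε], by simp [hε.ne']⟩
    have hc : (κ ∘ ψ) w = (κ ∘ ψ) (ζ x₀) := by
      refine isOpen_ball.is_const_of_deriv_eq_zero (convex_ball (ζ x₀) ε).isPreconnected
        (fun z hz => (hball z hz).1.2.differentiableWithinAt) (fun z hz => (hball z hz).1.1) hw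
        (mem_ball_self hε)
    have hψw : ψ w = ψ (ζ x₀) := κ.injOn (hball w hw).2.2 (hball _ (mem_ball_self hε)).2.2 hc
    exact hwne ((Λ.flowBox i).injective (hball w hw).2.1 hz₀ hψw).1
  · by_cases hfreq : ∃ᶠ x in 𝓝 x₀, deriv (κ ∘ ψ) (ζ x) ≠ 0
    · have h1 : ∃ᶠ x in 𝓝 x₀, H x ∈ ({0} : Set ℂ) := (hfreq.and_eventually himm).mono
        fun x hx => hx.2 hx.1
      exact isClosed_singleton.mem_of_frequently_of_tendsto h1 hHc
    · have h1 : ∀ᶠ x in 𝓝 x₀, ζ x = ζ x₀ := by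
        have h2 := hζc.eventually (eventually_nhdsWithin_iff.1 hne)
        filter_upwards [h2, not_frequently.1 hfreq] with x hx hx'
        by_contra h
        exact hx' (hx h)
      have h2 : (κ ∘ φ) =ᶠ[𝓝 x₀] fun _ => κ (φ x₀) := by
        filter_upwards [h1, hφev] with x hx hx'
        rw [Function.comp_apply, ← (hζN x hx'.1).2, hx, ← hψ₀]
      simp only [hH, h2.deriv_eq, deriv_const, map_zero]

end Leaves

/-! ### The currents `T_r`, their normalization and their cluster points -/

section PushForward

variable {E : Type u} [NormedAddCommGroup E] [NormedSpace ℂ E]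
variable {M : Type u'} [TopologicalSpace M] [ChartedSpace E M]

/-- The fundamental form of a Hermitian metric. -/
def HermitianMetric.fundamentalForm (g : HermitianMetric E M) : ContForm11 E M :=
  ⟨fun p => (ContinuousLinearMap.compL ℝ E ℝ ℂ Complex.ofRealCLM).comp ((g.inner p).comp
    ((Complex.I • ContinuousLinearMap.id ℂ E).restrictScalars ℝ)), by
    have hI : ∀ a : E, Complex.I • Complex.I • a = -a := fun a => by
      rw [smul_smul, Complex.I_mul_I, neg_one_smul]
    have hval : ∀ p a b, (ContinuousLinearMap.compL ℝ E ℝ ℂ Complex.ofRealCLM).comp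
        ((g.inner p).comp ((Complex.I • ContinuousLinearMap.id ℂ E).restrictScalars ℝ)) a b
        = (g.inner p (Complex.I • a) b : ℂ) := fun p a b => rfl
    refine ⟨fun p a => ?_, fun p a b => ?_, fun x₀ => ?_⟩
    · have h1 := g.inner_I p (Complex.I • a) a
      rw [hI, map_neg, _root_.neg_apply, g.symm p a] at h1
      have h2 : g.inner p (Complex.I • a) a = 0 := by linarith
      rw [hval, h2, Complex.ofReal_zero]
    · rw [hval, hval, g.inner_I]
    · refine ((continuousOn_const (c := ContinuousLinearMap.compL ℝ E ℝ ℂ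
        Complex.ofRealCLM)).clm_comp ((g.continuousOn_bilinInChart x₀).clm_comp (continuousOn_const
          (c := (Complex.I • ContinuousLinearMap.id ℂ E).restrictScalars ℝ)))).congr
            fun p _ => ?_
      ext a b
      simp [bilinInChart]⟩

theorem HermitianMetric.fundamentalForm_apply (g : HermitianMetric E M) (p : M) (a b : E) :
    (g.fundamentalForm : M → E →L[ℝ] E →L[ℝ] ℂ) p a b = g.inner p (Complex.I • a) b := rfl

/-- The squared length of the velocity of a disc. -/
def speedSq (g : HermitianMetric E M) (φ : ℂ → M) (x : ℂ) : ℝ :=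
  g.length (φ x) (discDeriv φ x) ^ 2

theorem speedSq_nonneg (g : HermitianMetric E M) (φ : ℂ → M) (x : ℂ) : 0 ≤ speedSq g φ x :=
  sq_nonneg _

theorem massFactor_eq (g : HermitianMetric E M) (φ : ℂ → M) :
    massFactor g φ = weightedMass (speedSq g φ) := rfl

variable {g : HermitianMetric E M} {φ : ℂ → M}

theorem pushGreen_smul (a : ℂ) (η : ContForm11 E M) (r : ℝ) :
    pushGreen φ r (a • η) = a * pushGreen φ r η := by
  rw [pushGreen, pushGreen, ← integral_const_mul]
  refine integral_congr_ae (Eventually.of_forall fun x => ?_)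
  simp only [greenPullback, Submodule.coe_smul, Pi.smul_apply, _root_.smul_apply, smul_eq_mul]
  ring

/-- On `(φ', iφ')` the fundamental form takes the value `g(iφ', iφ') = |φ'|²`, so this pairing
measures the mass of `T_r`. -/
theorem pushGreen_fundamentalForm (r : ℝ) : pushGreen φ r g.fundamentalForm
    = ((∫ x in ball (0 : ℂ) 1, green r x * speedSq g φ x : ℝ) : ℂ) := by
  rw [pushGreen, ← integral_complex_ofReal]
  refine integral_congr_ae (Eventually.of_forall fun x => ?_)
  simp only [greenPullback, g.fundamentalForm_apply, g.inner_I, speedSq, g.length_sq]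
  push_cast
  rfl

theorem pushGreen_eq_zero {η : ContForm11 E M} (h : ∀ x ∈ ball (0 : ℂ) 1,
    (η : M → E →L[ℝ] E →L[ℝ] ℂ) (φ x) (discDeriv φ x) (Complex.I • discDeriv φ x) = 0) (r : ℝ) :
    pushGreen φ r η = 0 := by
  rw [pushGreen, setIntegral_congr_fun (g := fun _ => 0) measurableSet_ball, integral_zero]
  intro x hx
  simp only [greenPullback, h x hx, mul_zero]

theorem pushGreen_nonneg {η : ContForm11 E M} (hη : IsNonneg η) (r : ℝ) :
    0 ≤ pushGreen φ r η :=
  integral_nonneg fun x => mul_nonneg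
    (Complex.zero_le_real.2 (green_nonneg r x)) (hη _ _)

/-- The normalized family `T_r / A(r)`. -/
def normalizedPush (g : HermitianMetric E M) (φ : ℂ → M) (r : ℝ) (η : ContForm11 E M) : ℂ :=
  pushGreen φ r η / (massFactor g φ r : ℂ)

/-- Evaluation at a form is continuous for the weak topology, so vanishing passes to cluster points.
Both the support statement and directedness reduce to this. -/
theorem eq_zero_of_mapClusterPt {F : ContForm11 E M → ℂ}
    (hF : MapClusterPt F (𝓝[<] (1 : ℝ)) (normalizedPush g φ)) {η : ContForm11 E M} (h : ∀ x ∈ ball (0 : ℂ) 1,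
    (η : M → E →L[ℝ] E →L[ℝ] ℂ) (φ x) (discDeriv φ x) (Complex.I • discDeriv φ x) = 0) :
    F η = 0 :=
  (isClosed_eq (continuous_apply η) continuous_const).mem_of_mapClusterPt hF
    (Eventually.of_forall fun r => by
      change normalizedPush g φ r η = 0
      rw [normalizedPush, pushGreen_eq_zero h, zero_div])

theorem nonneg_of_mapClusterPt {F : ContForm11 E M → ℂ}
    (hF : MapClusterPt F (𝓝[<] (1 : ℝ)) (normalizedPush g φ)) {η : ContForm11 E M}
    (hη : IsNonneg η) : 0 ≤ F η :=
  (isClosed_le continuous_const (continuous_apply η)).mem_of_mapClusterPt hF (by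
    filter_upwards [Ioo_mem_nhdsLT (zero_lt_one' ℝ)] with r hr
    rw [normalizedPush, div_eq_mul_inv, ← Complex.ofReal_inv]
    refine mul_nonneg (pushGreen_nonneg hη r) (Complex.zero_le_real.2 (inv_nonneg.2 ?_))
    exact weightedMass_nonneg (speedSq_nonneg g φ) hr.2)

theorem apply_eq_zero_of_tsupport_subset {η : ContForm11 E M} {U : Set M}
    (hη : tsupport (η : M → E →L[ℝ] E →L[ℝ] ℂ) ⊆ U) {p : M} (hp : p ∉ U) (a b : E) :
    (η : M → E →L[ℝ] E →L[ℝ] ℂ) p a b = 0 := by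
  rw [image_eq_zero_of_notMem_tsupport fun h => hp (hη h)]
  simp

theorem Current.support_subset_of_mapClusterPt {T : Current g}
    (hT : MapClusterPt (T : ContForm11 E M → ℂ) (𝓝[<] (1 : ℝ)) (normalizedPush g φ)) :
    T.support ⊆ closure (φ '' ball 0 1) := by
  intro p hp
  by_contra hpc
  obtain ⟨η, hη, hne⟩ := hp _ (isClosed_closure.isOpen_compl.mem_nhds hpc)
  exact hne (eq_zero_of_mapClusterPt hT fun x hx => apply_eq_zero_of_tsupport_subset hη
    (fun h => h (subset_closure ⟨x, hx, rfl⟩)) _ _)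

variable [FiniteDimensional ℂ E] [IsManifold 𝓘(ℂ, E) ω M]

section

variable (hφ : MDifferentiableOn 𝓘(ℂ, ℂ) 𝓘(ℂ, E) φ (ball 0 1))
include hφ

theorem continuousOn_speedSq : ContinuousOn (speedSq g φ) (ball 0 1) := by
  have : CompleteSpace E := FiniteDimensional.complete ℂ E
  have h := continuousOn_bilin_discDeriv (g.continuousOn_bilinInChart) isOpen_ball hφ 1
  refine h.congr fun x _ => ?_
  simp only [speedSq, g.length_sq, one_smul]

theorem continuousOn_pullback (η : ContForm11 E M) :
    ContinuousOn (fun x => (η : M → E →L[ℝ] E →L[ℝ] ℂ) (φ x) (discDeriv φ x)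
      (Complex.I • discDeriv φ x)) (ball 0 1) := by
  have : CompleteSpace E := FiniteDimensional.complete ℂ E
  exact continuousOn_bilin_discDeriv η.2.2.2 isOpen_ball hφ Complex.I

theorem integrableOn_greenPullback (η : ContForm11 E M) {r : ℝ} (hr : r ∈ Set.Ioo (0 : ℝ) 1) :
    IntegrableOn (greenPullback φ η r) (ball 0 1) :=
  integrableOn_green_mul (continuousOn_pullback hφ η) hr

theorem pushGreen_add (η θ : ContForm11 E M) {r : ℝ} (hr : r ∈ Set.Ioo (0 : ℝ) 1) :
    pushGreen φ r (η + θ) = pushGreen φ r η + pushGreen φ r θ := by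
  rw [pushGreen, pushGreen, pushGreen, ← integral_add (integrableOn_greenPullback hφ η hr)
    (integrableOn_greenPullback hφ θ hr)]
  refine integral_congr_ae (Eventually.of_forall fun x => ?_)
  simp [greenPullback, mul_add]

theorem norm_pushGreen_le (η : ContForm11 E M) {c : ℝ}
    (hη : ∀ p a b, ‖(η : M → E →L[ℝ] E →L[ℝ] ℂ) p a b‖ ≤ c * g.length p a * g.length p b)
    {r : ℝ} (hr : r ∈ Set.Ioo (0 : ℝ) 1) :
    ‖pushGreen φ r η‖ ≤ (∫ x in ball (0 : ℂ) 1, green r x * speedSq g φ x) * c := by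
  rw [pushGreen, ← integral_mul_const]
  refine norm_integral_le_of_norm_le
    ((integrableOn_green_mul (𝕜 := ℝ) (continuousOn_speedSq hφ) hr).mul_const c)
    (Eventually.of_forall fun x => ?_)
  rw [greenPullback, norm_mul, Complex.norm_real, Real.norm_of_nonneg (green_nonneg r x), mul_assoc]
  refine mul_le_mul_of_nonneg_left ((hη _ _ _).trans_eq ?_) (green_nonneg r x)
  rw [g.length_I_smul, speedSq]
  ring

theorem exists_current_pushGreen {r : ℝ} (hr : r ∈ Set.Ioo (0 : ℝ) 1) :
    ∃ T : Current g, ∀ η, T η = pushGreen φ r η :=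
  ⟨{ toFun := pushGreen φ r
     map_add' := fun η θ => pushGreen_add hφ η θ hr
     map_smul' := fun a η => pushGreen_smul a η r
     bounded := ⟨_, fun η _ _ hη => norm_pushGreen_le hφ η hη hr⟩ }, fun _ => rfl⟩

end

/-- By `contDiffAt_comp_disc` the pairing is half the Green integral of `Δ(f ∘ φ)`, and compactness
of `M` bounds `f ∘ φ`. -/
theorem pushGreen_ddbar_bounded [CompactSpace M]
    (hφ : MDifferentiableOn 𝓘(ℂ, ℂ) 𝓘(ℂ, E) φ (ball 0 1)) {f : M → ℂ}
    (hf : ContMDiff 𝓘(ℝ, E) 𝓘(ℝ, ℂ) ∞ f) :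
    ∃ C, ∀ r ∈ Set.Ioo (1 / 4 : ℝ) 1, ‖pushGreen φ r (ddbar f hf)‖ ≤ C := by
  have : CompleteSpace E := FiniteDimensional.complete ℂ E
  obtain ⟨C, hC⟩ := isCompact_univ.exists_bound_of_continuousOn hf.continuous.continuousOn
  have hcomp := fun x hx => contDiffAt_comp_disc hf isOpen_ball hφ (x := x) hx
  obtain ⟨C', hC'⟩ := exists_norm_integral_green_mul_lap_le (fun x hx => (hcomp x hx).1)
    (fun x => hC (φ x) (Set.mem_univ _))
  refine ⟨‖(1 / 2 : ℂ)‖ * C', fun r hr => ?_⟩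
  have h : pushGreen φ r (ddbar f hf)
      = (1 / 2 : ℂ) * ∫ x in ball (0 : ℂ) 1, (green r x : ℂ) * lap (f ∘ φ) x := by
    rw [pushGreen, ← integral_const_mul]
    refine setIntegral_congr_fun measurableSet_ball fun x hx => ?_
    have h1 := (hcomp x hx).2
    simp only [greenPullback, ddbar]
    rw [h1, Complex.real_smul]
    push_cast
    ring
  rw [h, norm_mul]
  exact mul_le_mul_of_nonneg_left (hC' r hr) (norm_nonneg _)

section Limits

variable (hφ : MDifferentiableOn 𝓘(ℂ, ℂ) 𝓘(ℂ, E) φ (ball 0 1))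
  (hinf : ∫⁻ x in ball (0 : ℂ) 1, ENNReal.ofReal ((1 - ‖x‖) * speedSq g φ x) = ⊤)
include hφ hinf

theorem tendsto_massFactor : Tendsto (massFactor g φ) (𝓝[<] 1) atTop :=
  tendsto_weightedMass (continuousOn_speedSq hφ) (speedSq_nonneg g φ) hinf

/-- One constant works for all forms and all `r` near `1`. This gives compactness and also survives
in the limit as the order `0` bound. -/
theorem exists_norm_normalizedPush_le : ∃ K, 0 ≤ K ∧ ∀ᶠ r in 𝓝[<] (1 : ℝ),
    ∀ (η : ContForm11 E M) (c : ℝ), 0 ≤ c →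
      (∀ p a b, ‖(η : M → E →L[ℝ] E →L[ℝ] ℂ) p a b‖ ≤ c * g.length p a * g.length p b) →
      ‖normalizedPush g φ r η‖ ≤ K * c := by
  obtain ⟨K, hK, hle⟩ := exists_integral_green_le (continuousOn_speedSq hφ) (speedSq_nonneg g φ) hinf
  refine ⟨K, hK, ?_⟩
  filter_upwards [hle, (tendsto_massFactor hφ hinf).eventually_ge_atTop 1,
    Ioo_mem_nhdsLT (zero_lt_one' ℝ)] with r h1 h2 hr η c hc hη
  have h0 : 0 < massFactor g φ r := one_pos.trans_le h2
  rw [normalizedPush, norm_div, Complex.norm_real, Real.norm_of_nonneg h0.le, div_le_iff₀ h0]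
  refine (norm_pushGreen_le hφ η hη hr).trans ?_
  rw [← massFactor_eq] at h1
  calc _ ≤ (K * massFactor g φ r) * c := by gcongr
    _ = _ := by ring

/-- The weak topology is that of pointwise convergence on forms, and the family eventually lies in a
product of closed discs, compact by Tychonoff's theorem. -/
theorem exists_mapClusterPt_normalizedPush [CompactSpace M] :
    ∃ F, MapClusterPt F (𝓝[<] (1 : ℝ)) (normalizedPush g φ) := by
  obtain ⟨K, -, hK⟩ := exists_norm_normalizedPush_le hφ hinf
  choose c hc0 hc using fun η : ContForm11 E M => exists_comass_bound g η.2.2.2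
  have hcomp : IsCompact (Set.univ.pi fun η : ContForm11 E M => closedBall (0 : ℂ) (K * c η)) :=
    isCompact_univ_pi fun η => isCompact_closedBall _ _
  obtain ⟨F, -, hF⟩ := hcomp.exists_mapClusterPt_of_frequently (l := 𝓝[<] (1 : ℝ))
    (f := normalizedPush g φ) (Eventually.frequently (by
      filter_upwards [hK] with r hr η _
      rw [mem_closedBall_zero_iff]
      exact hr η (c η) (hc0 η) (hc η)))
  exact ⟨F, hF⟩

variable {F : ContForm11 E M → ℂ} (hF : MapClusterPt F (𝓝[<] (1 : ℝ)) (normalizedPush g φ))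
include hF

theorem exists_current_eq_of_mapClusterPt : ∃ T : Current g, (T : ContForm11 E M → ℂ) = F := by
  obtain ⟨K, -, hK⟩ := exists_norm_normalizedPush_le hφ hinf
  have hadd : ∀ η θ, F (η + θ) = F η + F θ := fun η θ => by
    have hcl : IsClosed {G : ContForm11 E M → ℂ | G (η + θ) = G η + G θ} :=
      isClosed_eq (by fun_prop) (by fun_prop)
    refine hcl.mem_of_mapClusterPt hF ?_
    filter_upwards [Ioo_mem_nhdsLT (zero_lt_one' ℝ)] with r hr
    simp only [normalizedPush, pushGreen_add hφ η θ hr, add_div]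
  have hsmul : ∀ (a : ℂ) η, F (a • η) = a * F η := fun a η => by
    have hcl : IsClosed {G : ContForm11 E M → ℂ | G (a • η) = a * G η} :=
      isClosed_eq (by fun_prop) (by fun_prop)
    refine hcl.mem_of_mapClusterPt hF (Eventually.of_forall fun r => ?_)
    change normalizedPush g φ r (a • η) = a * normalizedPush g φ r η
    rw [normalizedPush, pushGreen_smul, mul_div_assoc, normalizedPush]
  refine ⟨{ toFun := F, map_add' := hadd, map_smul' := hsmul, bounded := ⟨K, fun η c hc hη => ?_⟩ },
    rfl⟩
  have hcl : IsClosed {G : ContForm11 E M → ℂ | ‖G η‖ ≤ K * c} :=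
    isClosed_le (by fun_prop) (by fun_prop)
  exact hcl.mem_of_mapClusterPt hF (hK.mono fun r hr => hr η c hc hη)

/-- The lower comparison of `G_r` with `r - |x|` keeps the normalized mass above `1 / 2π`, which
prevents the limit from vanishing. -/
theorem re_fundamentalForm_pos_of_mapClusterPt : 0 < (F g.fundamentalForm).re := by
  have hcl : IsClosed {G : ContForm11 E M → ℂ | (2 * Real.pi)⁻¹ ≤ (G g.fundamentalForm).re} :=
    isClosed_le continuous_const
      (Complex.continuous_re.comp (continuous_apply (A := fun _ => ℂ) g.fundamentalForm))
  have h : (2 * Real.pi)⁻¹ ≤ (F g.fundamentalForm).re := by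
    refine hcl.mem_of_mapClusterPt hF ?_
    filter_upwards [(tendsto_massFactor hφ hinf).eventually_ge_atTop 1,
      Ioo_mem_nhdsLT (zero_lt_one' ℝ)] with r h1 hr
    have h0 : 0 < massFactor g φ r := one_pos.trans_le h1
    rw [normalizedPush, pushGreen_fundamentalForm, ← Complex.ofReal_div,
      Complex.ofReal_re, le_div_iff₀ h0]
    exact weightedMass_le_integral_green (continuousOn_speedSq hφ) (speedSq_nonneg g φ) hr
  have : 0 < (2 * Real.pi)⁻¹ := by positivity
  linarith

/-- A bounded numerator is divided by `A(r) → ∞`. -/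
theorem ddbar_eq_zero_of_mapClusterPt [CompactSpace M] {f : M → ℂ}
    (hf : ContMDiff 𝓘(ℝ, E) 𝓘(ℝ, ℂ) ∞ f) : F (ddbar f hf) = 0 := by
  obtain ⟨C, hC⟩ := pushGreen_ddbar_bounded hφ hf
  have hlim : Tendsto (fun r => C / massFactor g φ r) (𝓝[<] 1) (𝓝 0) :=
    (tendsto_massFactor hφ hinf).const_div_atTop C
  rw [← norm_le_zero_iff]
  refine le_of_forall_pos_le_add fun ε hε => ?_
  rw [zero_add]
  have hcl : IsClosed {G : ContForm11 E M → ℂ | ‖G (ddbar f hf)‖ ≤ ε} :=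
    isClosed_le (by fun_prop) (by fun_prop)
  refine hcl.mem_of_mapClusterPt hF ?_
  filter_upwards [hlim.eventually_le_const hε, (tendsto_massFactor hφ hinf).eventually_ge_atTop 1,
    Ioo_mem_nhdsLT (by norm_num : (1 / 4 : ℝ) < 1)] with r h1 h2 hr
  have h0 : 0 < massFactor g φ r := one_pos.trans_le h2
  rw [normalizedPush, norm_div, Complex.norm_real, Real.norm_of_nonneg h0.le]
  refine le_trans ?_ h1
  gcongr
  exact hC r hr

end Limits

theorem Lamination.directs_of_mapClusterPt [CompactSpace M] [T2Space M] {T : Current g}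
    (hφ : MDifferentiableOn 𝓘(ℂ, ℂ) 𝓘(ℂ, E) φ (ball 0 1))
    (hT : MapClusterPt (T : ContForm11 E M → ℂ) (𝓝[<] (1 : ℝ)) (normalizedPush g φ))
    {Λ : Lamination.{u, u', v, w} E M} {L : Set M} (hL : Λ.IsLeaf L) (hφL : φ '' ball 0 1 ⊆ L) :
    Λ.Directs T := by
  have : CompleteSpace E := FiniteDimensional.complete ℂ E
  have : ProperSpace E := FiniteDimensional.proper ℂ E
  have : SecondCountableTopology M := ChartedSpace.secondCountable_of_sigmaCompact E M
  have hφX : φ '' ball 0 1 ⊆ Λ.X := hφL.trans (hL.1.1.trans Set.sdiff_subset)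
  refine ⟨(Current.support_subset_of_mapClusterPt hT).trans
    (closure_minimal hφX Λ.isCompact_X.isClosed), ?_⟩
  intro U hU _ γ hγ j β _ _ η hηU hη
  refine eq_zero_of_mapClusterPt hT fun x hx => ?_
  -- Over `U`, `γ j` kills `φ'` and, being complex linear, also `iφ'`, so both terms of `γ ∧ β`
  -- vanish on `(φ', iφ')`. Off `U` the test form itself is zero.
  by_cases hxU : φ x ∈ U
  · have h0 := hγ.apply_discDeriv_eq_zero hL isOpen_ball hφ hφL hU j hx hxU
    rw [hη (φ x) ⟨hφX ⟨x, hx, rfl⟩, hxU⟩, (γ j (φ x)).map_smul, h0]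
    simp
  · exact apply_eq_zero_of_tsupport_subset hηU hxU _ _

end PushForward

end

end HarmonicCurrents

/-! ### Assembly of the theorem -/

open HarmonicCurrents in
theorem theorem4p7 {E : Type u} [NormedAddCommGroup E] [NormedSpace ℂ E] [FiniteDimensional ℂ E]
    {M : Type u'} [TopologicalSpace M] [ChartedSpace E M] [IsManifold 𝓘(ℂ, E) ω M]
    [CompactSpace M] [T2Space M] (g : HermitianMetric E M)
    (φ : ℂ → M) (hφ : MDifferentiableOn 𝓘(ℂ, ℂ) 𝓘(ℂ, E) φ (ball 0 1))
    (hinf : ∫⁻ x in ball (0 : ℂ) 1,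
      ENNReal.ofReal ((1 - ‖x‖) * g.length (φ x) (discDeriv φ x) ^ 2) = ⊤) :
    (∀ r ∈ Set.Ioo (0 : ℝ) 1, ∃ T : Current g, ∀ η : ContForm11 E M,
      IntegrableOn (greenPullback φ η r) (ball 0 1) ∧ T η = pushGreen φ r η) ∧
    (∃ T : Current g, MapClusterPt (T : ContForm11 E M → ℂ) (𝓝[<] (1 : ℝ))
      (fun r η => pushGreen φ r η / (massFactor g φ r : ℂ))) ∧
    ∀ F : ContForm11 E M → ℂ,
      MapClusterPt F (𝓝[<] (1 : ℝ)) (fun r η => pushGreen φ r η / (massFactor g φ r : ℂ)) →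
      ∃ T : Current g, (T : ContForm11 E M → ℂ) = F ∧
        (∃ η, T η ≠ 0) ∧ T.IsPositive ∧ T.IsHarmonic ∧
        T.support ⊆ closure (φ '' ball 0 1) ∧
        ∀ (Λ : Lamination.{u, u', v, w} E M) (L : Set M), Λ.IsLeaf L → φ '' ball 0 1 ⊆ L →
          Λ.Directs T := by
  obtain ⟨F₀, hF₀⟩ := exists_mapClusterPt_normalizedPush hφ hinf
  refine ⟨fun r hr => ?_, ?_, fun F hF => ?_⟩
  · obtain ⟨T, hT⟩ := exists_current_pushGreen (g := g) hφ hr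
    exact ⟨T, fun η => ⟨integrableOn_greenPullback hφ η hr, hT η⟩⟩
  · obtain ⟨T, rfl⟩ := exists_current_eq_of_mapClusterPt hφ hinf hF₀
    exact ⟨T, hF₀⟩
  · obtain ⟨T, rfl⟩ := exists_current_eq_of_mapClusterPt hφ hinf hF
    have hpos := re_fundamentalForm_pos_of_mapClusterPt hφ hinf hF
    refine ⟨T, rfl, ⟨g.fundamentalForm, fun h => ?_⟩, fun η hη => nonneg_of_mapClusterPt hF hη,
      fun f hf => ddbar_eq_zero_of_mapClusterPt hφ hinf hF hf,
      Current.support_subset_of_mapClusterPt hF,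
      fun Λ L hL hφL => Lamination.directs_of_mapClusterPt hφ hF hL hφL⟩
    rw [h, Complex.zero_re] at hpos
    exact lt_irrefl _ hpos
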